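/- Call a finite nonempty sequence $\mathbf{k}=(k_1,\dots,k_r)$ of positive integers a composition, with weight $|\mathbf{k}|=k_1+\cdots+k_r$ and depth $\mathrm{dep}(\mathbf{k})=r$. Put $\overleftarrow{\mathbf{k}}=(k_r,\dots,k_1)$ and $\mathbf{k}_+=(k_1+1,k_2,\dots,k_r)$, and let the Hoffman dual $\mathbf{k}^\vee=(k'_1,\dots,k'_{r'})$ be the composition with $|\mathbf{k}^\vee|=|\mathbf{k}|$ for which $\{1,\dots,|\mathbf{k}|-1\}$ is the disjoint union of $\{k_1+\cdots+k_i : 1\le i\le r-1\}$ and $\{k'_1+\cdots+k'_i : 1\le i\le r'-1\}$. For $\mathbf{j}=(j_1,\dots,j_r)\in\mathbb{Z}_{\ge 0}^r$ let $|\mathbf{j}|=j_1+\cdots+j_r$, $\mathrm{dep}(\mathbf{j})=r$, $B(\mathbf{k};\mathbf{j})=\prod_{i=1}^r\binom{k_i+j_i-1}{j_i}$ and $\mathbf{k}+\mathbf{j}=(k_1+j_1,\dots,k_r+j_r)$. If $k_1>1$, let $$\zeta(\mathbf{k})=\lim_{N\to\infty}\sum_{N\ge n_1>\cdots>n_r>0}\frac{1}{n_1^{k_1}\cdots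 n_r^{k_r}},\qquad T(\mathbf{k})=\sum_{\substack{n_1>\cdots>n_r>0\\ n_i\equiv r+1-i\ (\mathrm{mod}\ 2)\ \forall i}}\frac{2^r}{n_1^{k_1}\cdots n_r^{k_r}}.$$ For any composition $\mathbf{k}$ and $|x|<1$ let $$\mathrm{Li}_{\mathbf{k}}(x)=\sum_{n_1>\cdots>n_r>0}\frac{x^{n_1}}{n_1^{k_1}\cdots n_r^{k_r}},\qquad \mathrm{A}(\mathbf{k};x)=2^r\sum_{\substack{n_1>\cdots>n_r>0\\ n_i\equiv r+1-i\ (\mathrm{mod}\ 2)\ \forall i}}\frac{x^{n_1}}{n_1^{k_1}\cdots n_r^{k_r}},$$ and for $\Re(s)>0$ let $$\xi(s;\mathbf{k})=\frac{1}{\Gamma(s)}\int_0^\infty\frac{t^{s-1}}{e^t-1}\,\mathrm{Li}_{\mathbf{k}}(1-e^{-t})\,dt,\qquad \psi(s;\mathbf{k})=\frac{1}{\Gamma(s)}\int_0^\infty\frac{t^{s-1}}{\sinh t}\,\mathrm{A}(\mathbf{k};\tanh(t/2))\,dt.$$ Let $\mathbf{k}$ be a composition, let $k\ge 0$ be an integer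 and put $n=|\mathbf{k}|+1-\mathrm{dep}(\mathbf{k})$, which is the depth of $(\overleftarrow{\mathbf{k}}^\vee)_+$. Then the integrals that define $\xi(k+1;\mathbf{k})$ and $\psi(k+1;\mathbf{k})$, the series $\mathrm{Li}_{\mathbf{k}}$ and $\mathrm{A}(\mathbf{k};\cdot)$ in their integrands, and all the limits and series on the right-hand sides below converge, and $$\xi(k+1;\mathbf{k})=\sum_{\mathbf{j}\in\mathbb{Z}_{\ge0}^n,\ |\mathbf{j}|=k} B\big((\overleftarrow{\mathbf{k}}^\vee)_+;\mathbf{j}\big)\,\zeta\big((\overleftarrow{\mathbf{k}}^\vee)_++\mathbf{j}\big),$$ $$\psi(k+1;\mathbf{k})=\sum_{\mathbf{j}\in\mathbb{Z}_{\ge0}^n,\ |\mathbf{j}|=k} B\big((\overleftarrow{\mathbf{k}}^\vee)_+;\mathbf{j}\big)\,T\big((\overleftarrow{\mathbf{k}}^\vee)_++\mathbf{j}\big).$$ -/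

import Mathlib

open Filter Topology

/-- A composition: a nonempty finite sequence of positive integers `(k₁, …, k_r)`.
Its weight is `k.sum` and its depth is `k.length`. -/
def IsComposition (k : List ℕ) : Prop :=
  k ≠ [] ∧ ∀ a ∈ k, 0 < a

/-- `k₊ = (k₁ + 1, k₂, …, k_r)`. -/
def plusOne : List ℕ → List ℕ
  | [] => []
  | a :: l => (a + 1) :: l

/-- The Hoffman dual
`k^∨ = (1, …, 1 + 1, …, 1 + ⋯ + 1, …, 1)` with blocks of `k₁`, `k₂`, …, `k_r` ones, where the last
entry of each block is added to the first entry of the next block.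
See `hoffmanDual_isComposition`, `sum_hoffmanDual`, `properPartialSums_hoffmanDual` for the
properties that determine it. -/
def hoffmanDual : List ℕ → List ℕ
  | [] => []
  | [a] => List.replicate a 1
  | a :: b :: l => List.replicate (a - 1) 1 ++ plusOne (hoffmanDual (b :: l))

/-- `B(k; j) = ∏ᵢ binom(kᵢ + jᵢ - 1, jᵢ)` (used for sequences of the same length). -/
def multiBinom (k j : List ℕ) : ℕ :=
  (List.zipWith (fun a b => (a + b - 1).choose b) k j).prod

/-- Component-wise sum `k + j` (used for sequences of the same length). -/
def addComp (k j : List ℕ) : List ℕ :=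
  List.zipWith (fun a b => a + b) k j

/-- The multiple harmonic sum
`ζ_N(k) = ∑_{N ≥ n₁ > ⋯ > n_r > 0} 1 / (n₁ ^ k₁ ⋯ n_r ^ k_r)`. -/
noncomputable def multHarmonicSum (k : List ℕ) (N : ℕ) : ℝ :=
  open Classical in
  ∑ n ∈ (Fintype.piFinset fun _ : Fin k.length => Finset.Icc 1 N).filter (fun n => StrictAnti n),
    ∏ i, 1 / (n i : ℝ) ^ k.get i

/-- The multiple zeta value `ζ(k) = lim_{N → ∞} ζ_N(k)` (for `k₁ > 1`). -/
noncomputable def multZeta (k : List ℕ) : ℝ :=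
  limUnder atTop (multHarmonicSum k)

/-- Index set of sums over `n₁ > ⋯ > n_r > 0`. -/
def DecTuple (r : ℕ) : Type :=
  {n : Fin r → ℕ // StrictAnti n ∧ ∀ i, 0 < n i}

/-- Index set of sums over `n₁ > ⋯ > n_r > 0` with `n_j ≡ r + 1 - j (mod 2)` for `1 ≤ j ≤ r`;
here the position `j` is `i + 1` with `i : Fin r`. -/
def ParityTuple (r : ℕ) : Type :=
  {n : Fin r → ℕ // StrictAnti n ∧ (∀ i, 0 < n i) ∧ ∀ i : Fin r, n i ≡ r - (i : ℕ) [MOD 2]}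

/-- `x ^ n₁`, the power of the variable that belongs to the first (largest) index. -/
noncomputable def leadPow {r : ℕ} (x : ℂ) (n : Fin r → ℕ) : ℂ :=
  ∏ i : Fin r, if (i : ℕ) = 0 then x ^ n i else 1

/-- The general term `x ^ n₁ / (n₁ ^ k₁ ⋯ n_r ^ k_r)`. -/
noncomputable def polylogTerm (k : List ℕ) (x : ℂ) (n : Fin k.length → ℕ) : ℂ :=
  leadPow x n / ∏ i, (n i : ℂ) ^ k.get i

/-- The single-variable multiple polylogarithm
`Li_k(x) = ∑_{n₁ > ⋯ > n_r > 0} x ^ n₁ / (n₁ ^ k₁ ⋯ n_r ^ k_r)`. -/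
noncomputable def multPolylog (k : List ℕ) (x : ℂ) : ℂ :=
  ∑' n : DecTuple k.length, polylogTerm k x n.1

/-- The Kaneko–Tsumura A-function, `2 ^ r` times the sum of `x ^ n₁ / (n₁ ^ k₁ ⋯ n_r ^ k_r)`
over `n₁ > ⋯ > n_r > 0` with `n_j ≡ r + 1 - j (mod 2)`. -/
noncomputable def kanekoTsumuraA (k : List ℕ) (x : ℂ) : ℂ :=
  2 ^ k.length * ∑' n : ParityTuple k.length, polylogTerm k x n.1

/-- The general term `2 ^ r / (n₁ ^ k₁ ⋯ n_r ^ k_r)`. -/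
noncomputable def multTTerm (k : List ℕ) (n : Fin k.length → ℕ) : ℝ :=
  2 ^ k.length / ∏ i, (n i : ℝ) ^ k.get i

/-- The multiple T-value (for `k₁ > 1`): the sum of `2 ^ r / (n₁ ^ k₁ ⋯ n_r ^ k_r)`
over `n₁ > ⋯ > n_r > 0` with `n_j ≡ r + 1 - j (mod 2)`. -/
noncomputable def multT (k : List ℕ) : ℝ :=
  ∑' n : ParityTuple k.length, multTTerm k n.1

/-- The integrand `t ^ (s - 1) / (e ^ t - 1) * Li_k(1 - e ^ (-t))`. -/
noncomputable def xiIntegrand (s : ℂ) (k : List ℕ) (t : ℝ) : ℂ :=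
  (t : ℂ) ^ (s - 1) / ((Real.exp t - 1 : ℝ) : ℂ) * multPolylog k ((1 - Real.exp (-t) : ℝ) : ℂ)

/-- The Arakawa–Kaneko zeta function `ξ(s; k)`, for `Re s > 0`. -/
noncomputable def arakawaKanekoXi (s : ℂ) (k : List ℕ) : ℂ :=
  1 / Complex.Gamma s * ∫ t in Set.Ioi (0 : ℝ), xiIntegrand s k t

/-- The integrand `t ^ (s - 1) / sinh t * A(k; tanh (t / 2))`. -/
noncomputable def psiIntegrand (s : ℂ) (k : List ℕ) (t : ℝ) : ℂ :=
  (t : ℂ) ^ (s - 1) / (Real.sinh t : ℂ) * kanekoTsumuraA k (Real.tanh (t / 2) : ℂ)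

/-- The Kaneko–Tsumura function `ψ(s; k)`, for `Re s > 0`. -/
noncomputable def kanekoTsumuraPsi (s : ℂ) (k : List ℕ) : ℂ :=
  1 / Complex.Gamma s * ∫ t in Set.Ioi (0 : ℝ), psiIntegrand s k t

/-! The Hoffman dual is the composition of the same weight whose set of proper partial sums is the
complement of that of `k` in `{1, …, |k| - 1}`. -/

/-- The set `{k₁ + ⋯ + k_j : 1 ≤ j ≤ r - 1}`. -/
def properPartialSums (k : List ℕ) : Set ℕ :=
  {x | ∃ j, 1 ≤ j ∧ j ≤ k.length - 1 ∧ (k.take j).sum = x}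

theorem sum_plusOne {k : List ℕ} (hk : k ≠ []) : (plusOne k).sum = k.sum + 1 := by
  cases k with
  | nil => exact absurd rfl hk
  | cons a l => simp [plusOne]; omega

theorem length_plusOne (k : List ℕ) : (plusOne k).length = k.length := by
  cases k <;> simp [plusOne]

theorem plusOne_isComposition {k : List ℕ} (hk : IsComposition k) :
    IsComposition (plusOne k) := by
  obtain ⟨h1, h2⟩ := hk
  cases k with
  | nil => exact absurd rfl h1
  | cons a l => exact ⟨by simp [plusOne], by simp [plusOne] at h2 ⊢; exact h2.2⟩

theorem IsComposition.tail {a b : ℕ} {l : List ℕ} (h : IsComposition (a :: b :: l)) :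
    IsComposition (b :: l) :=
  ⟨by simp, fun x hx => h.2 x (List.mem_cons_of_mem _ hx)⟩

theorem hoffmanDual_isComposition {k : List ℕ} (hk : IsComposition k) :
    IsComposition (hoffmanDual k) := by
  induction k using hoffmanDual.induct with
  | case1 => exact absurd rfl hk.1
  | case2 a =>
    have ha : 0 < a := hk.2 a (by simp)
    refine ⟨by simp [hoffmanDual]; omega, ?_⟩
    intro x hx
    simp only [hoffmanDual, List.mem_replicate] at hx
    omega
  | case3 a b l ih =>
    have h := plusOne_isComposition (ih hk.tail)
    refine ⟨by simp [hoffmanDual, h.1], ?_⟩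
    intro x hx
    simp only [hoffmanDual, List.mem_append, List.mem_replicate] at hx
    rcases hx with hx | hx
    · omega
    · exact h.2 x hx

/-- `|k^∨| = |k|`. -/
theorem sum_hoffmanDual {k : List ℕ} (hk : IsComposition k) :
    (hoffmanDual k).sum = k.sum := by
  induction k using hoffmanDual.induct with
  | case1 => exact absurd rfl hk.1
  | case2 a => simp [hoffmanDual]
  | case3 a b l ih =>
    have ha : 0 < a := hk.2 a (by simp)
    have h := ih hk.tail
    have h2 := sum_plusOne (hoffmanDual_isComposition hk.tail).1
    simp only [hoffmanDual, List.sum_append, List.sum_replicate, List.sum_cons] at h h2 ⊢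
    simp only [smul_eq_mul]
    omega

/-- `dep(k^∨) + dep(k) = |k| + 1`. -/
theorem length_hoffmanDual {k : List ℕ} (hk : IsComposition k) :
    (hoffmanDual k).length + k.length = k.sum + 1 := by
  induction k using hoffmanDual.induct with
  | case1 => exact absurd rfl hk.1
  | case2 a => simp [hoffmanDual]
  | case3 a b l ih =>
    have ha : 0 < a := hk.2 a (by simp)
    have h := ih hk.tail
    simp only [hoffmanDual, List.length_append, List.length_replicate, length_plusOne,
      List.sum_cons, List.length_cons] at h ⊢
    omega

/-- The depth of `((k reversed)^∨)₊` is `|k| + 1 - dep(k)`. -/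
theorem length_plusOne_hoffmanDual_reverse {k : List ℕ} (hk : IsComposition k) :
    (plusOne (hoffmanDual k.reverse)).length = k.sum + 1 - k.length := by
  have hr : IsComposition k.reverse :=
    ⟨by simpa using hk.1, fun a ha => hk.2 a (List.mem_reverse.1 ha)⟩
  have h := length_hoffmanDual hr
  rw [List.length_reverse, List.sum_reverse] at h
  rw [length_plusOne]
  omega

theorem mem_properPartialSums_cons {a : ℕ} {l : List ℕ} (hl : l ≠ []) (x : ℕ) :
    x ∈ properPartialSums (a :: l) ↔ x = a ∨ ∃ y ∈ properPartialSums l, x = a + y := by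
  have hlen : 0 < l.length := List.length_pos_iff.2 hl
  constructor
  · rintro ⟨j, h1, h2, rfl⟩
    obtain ⟨j, rfl⟩ := Nat.exists_eq_add_of_le' h1
    rcases Nat.eq_zero_or_pos j with rfl | hj
    · left; simp
    · right
      simp only [List.length_cons] at h2
      exact ⟨(l.take j).sum, ⟨j, hj, by omega, rfl⟩, by simp⟩
  · rintro (rfl | ⟨y, ⟨j, h1, h2, rfl⟩, rfl⟩)
    · exact ⟨1, le_rfl, by simp; omega, by simp⟩
    · exact ⟨j + 1, by omega, by simp; omega, by simp⟩

theorem mem_properPartialSums_plusOne {l : List ℕ} (x : ℕ) :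
    x ∈ properPartialSums (plusOne l) ↔ ∃ y ∈ properPartialSums l, x = y + 1 := by
  cases l with
  | nil => simp [plusOne, properPartialSums]
  | cons a l =>
    by_cases hl : l = []
    · subst hl
      simp [plusOne, properPartialSums]
    · simp only [plusOne, mem_properPartialSums_cons hl]
      constructor
      · rintro (rfl | ⟨y, hy, rfl⟩)
        · exact ⟨a, Or.inl rfl, rfl⟩
        · exact ⟨a + y, Or.inr ⟨y, hy, rfl⟩, by omega⟩
      · rintro ⟨y, (rfl | ⟨z, hz, rfl⟩), rfl⟩
        · exact Or.inl rfl
        · exact Or.inr ⟨z, hz, by omega⟩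

theorem mem_properPartialSums_replicate_append {l : List ℕ} (hl : l ≠ []) (c x : ℕ) :
    x ∈ properPartialSums (List.replicate c 1 ++ l) ↔
      (1 ≤ x ∧ x ≤ c) ∨ ∃ y ∈ properPartialSums l, x = c + y := by
  induction c generalizing x with
  | zero => simp; omega
  | succ c ih =>
    rw [List.replicate_succ, List.cons_append, mem_properPartialSums_cons (by simp [hl])]
    constructor
    · rintro (rfl | ⟨y, hy, rfl⟩)
      · left; omega
      · rcases (ih y).1 hy with h | ⟨z, hz, rfl⟩
        · left; omega
        · exact Or.inr ⟨z, hz, by omega⟩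
    · rintro (h | ⟨z, hz, rfl⟩)
      · by_cases hx : x = 1
        · exact Or.inl hx
        · exact Or.inr ⟨x - 1, (ih _).2 (Or.inl (by omega)), by omega⟩
      · exact Or.inr ⟨c + z, (ih _).2 (Or.inr ⟨z, hz, rfl⟩), by omega⟩

/-- `{1, …, |k| - 1}` is the disjoint union of the proper partial sums of `k` and of `k^∨`. -/
theorem properPartialSums_hoffmanDual {k : List ℕ} (hk : IsComposition k) :
    properPartialSums k ∪ properPartialSums (hoffmanDual k) = Set.Icc 1 (k.sum - 1) ∧
      Disjoint (properPartialSums k) (properPartialSums (hoffmanDual k)) := by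
  suffices H : ∀ x, ((x ∈ properPartialSums k ∨ x ∈ properPartialSums (hoffmanDual k)) ↔
      (1 ≤ x ∧ x ≤ k.sum - 1)) ∧
      ¬ (x ∈ properPartialSums k ∧ x ∈ properPartialSums (hoffmanDual k)) from
    ⟨Set.ext fun x => (H x).1, Set.disjoint_left.2 fun x h1 h2 => (H x).2 ⟨h1, h2⟩⟩
  induction k using hoffmanDual.induct with
  | case1 => exact absurd rfl hk.1
  | case2 a =>
    intro x
    have ha : 0 < a := hk.2 a (by simp)
    have h0 : x ∉ properPartialSums [a] := by
      rintro ⟨j, h1, h2, -⟩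
      simp at h2; omega
    have h1 : x ∈ properPartialSums (hoffmanDual [a]) ↔ 1 ≤ x ∧ x ≤ a - 1 := by
      obtain ⟨a, rfl⟩ := Nat.exists_eq_add_of_le' ha
      simp only [hoffmanDual, List.replicate_succ']
      rw [mem_properPartialSums_replicate_append (by simp)]
      constructor
      · rintro (h | ⟨y, ⟨j, h1, h2, -⟩, -⟩)
        · omega
        · simp at h2; omega
      · intro h
        left; omega
    simp [h0, h1]
  | case3 a b l ih =>
    intro x
    have ha : 0 < a := hk.2 a (by simp)
    have hb : 0 < b := hk.2 b (by simp)
    have IH := ih hk.tail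
    have hD := hoffmanDual_isComposition hk.tail
    have h1 : x ∈ properPartialSums (hoffmanDual (a :: b :: l)) ↔
        (1 ≤ x ∧ x ≤ a - 1) ∨ ∃ y ∈ properPartialSums (hoffmanDual (b :: l)), x = a + y := by
      rw [hoffmanDual, mem_properPartialSums_replicate_append (plusOne_isComposition hD).1]
      refine or_congr Iff.rfl ?_
      constructor
      · rintro ⟨y, hy, rfl⟩
        obtain ⟨z, hz, rfl⟩ := (mem_properPartialSums_plusOne y).1 hy
        exact ⟨z, hz, by omega⟩
      · rintro ⟨z, hz, rfl⟩
        exact ⟨z + 1, (mem_properPartialSums_plusOne _).2 ⟨z, hz, rfl⟩, by omega⟩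
    have h2 : ∀ S : Set ℕ, (∃ y ∈ S, x = a + y) ↔ (a ≤ x ∧ x - a ∈ S) := by
      intro S
      constructor
      · rintro ⟨y, hy, rfl⟩
        exact ⟨by omega, by simpa using hy⟩
      · rintro ⟨h, h'⟩
        exact ⟨x - a, h', by omega⟩
    rw [h1, mem_properPartialSums_cons (by simp), h2, h2]
    have I := IH (x - a)
    simp only [List.sum_cons] at I ⊢
    obtain ⟨I1, I2⟩ := I
    by_cases p : x - a ∈ properPartialSums (b :: l) <;>
      by_cases q : x - a ∈ properPartialSums (hoffmanDual (b :: l)) <;>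
      simp only [p, q, and_true, and_false, or_true, or_false, true_iff, false_iff,
        not_true_eq_false, not_false_eq_true] at I1 I2 ⊢ <;>
      omega

open MeasureTheory
open Set hiding antidiagonal mem_antidiagonal
open Finset.HasAntidiagonal (antidiagonal mem_antidiagonal)
open scoped ENNReal

/-! Both evaluations are one duality of iterated integrals, applied to two kernels. Write a sum over
`n₁ > ⋯ > n_r > 0` through its gaps `nᵢ - nᵢ₊₁`, with `n_{r+1} = 0`, each gap `d` weighted by `g d`:
weight 1 on positive gaps gives Li and ζ, weight 2 on odd gaps gives A and T. In both cases `∑ g_d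
e^{-dt} = G`, `∑ g_d x^d = 1/G` and `x' = G x` (`DualKernel`). So differentiating the generating
function in `t` either lowers a leading exponent above 1 and produces a factor `G`, or deletes a
leading entry 1 (`nestedGen_succ_cons`, `nestedGen_one_cons`).

The factor `t^m / m!` is the `y^m` coefficient of `e^{yt}`. Let `K_q(s)` be the `y^m` coefficient of
`∑_N e^{-(N-y)s} S_N(y)`, where `S_N(y)` is the nested sum of `q` with each `nᵢ` in the denominators
replaced by `nᵢ - y`. Integration over `(s, ∞)` divides by `N - y`, and multiplication by `G`
convolves with `g`. Hence `∫ K_q` raises the leading entry of `q`, while `∫ G K_q` prepends a 1: the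
factor `G` plays the opposite role to the one above, and this exchange is Hoffman duality.

Tonelli's theorem moves the integrations one by one from the generating function to `K`
(`lintegral_mul_expKernel_mul_nestedGen`, `lintegral_expKernel_mul_nestedGen`). Entries leave `k` at
its front and are added at the front of the dual, which causes the reversal; the last integral, over
`(0, ∞)`, supplies the plus (`DualKernel.lintegral_nestedGen`). Expanding `(n - y)^{-c}` binomially
gives the coefficients `B` (`nestedSumCoeff_eq_sum`). The computation takes place in `ℝ≥0∞`, so
convergence of the integrals follows from finiteness of the resulting sums
(`tsum_nestedSum_ne_top`). -/

/-- The Cauchy convolution of two sequences. -/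
noncomputable def cauchyConv (g F : ℕ → ℝ≥0∞) (N : ℕ) : ℝ≥0∞ :=
  ∑ p ∈ antidiagonal N, g p.1 * F p.2

/-- `∑ ∏ᵢ g (nᵢ - nᵢ₊₁) / nᵢ ^ kᵢ` over `N = n₁, n₂, …, n_r` with `n_{r+1} = 0`. -/
noncomputable def nestedSum (g : ℕ → ℝ≥0∞) : List ℕ → ℕ → ℝ≥0∞
  | [], N => if N = 0 then 1 else 0
  | c :: l, N => (N : ℝ≥0∞)⁻¹ ^ c * cauchyConv g (nestedSum g l) N

/-- The coefficients of the power series in `y` obtained from `nestedSum` on replacing each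
`nᵢ ^ kᵢ` by `(nᵢ - y) ^ kᵢ`. -/
noncomputable def nestedSumCoeff (g : ℕ → ℝ≥0∞) : List ℕ → ℕ → ℕ → ℝ≥0∞
  | [], N, a => if N = 0 ∧ a = 0 then 1 else 0
  | c :: l, N, a => ∑ p ∈ antidiagonal a,
      ((c + p.1 - 1).choose p.1 : ℝ≥0∞) * (N : ℝ≥0∞)⁻¹ ^ (c + p.1) *
        cauchyConv g (fun M => nestedSumCoeff g l M p.2) N

/-- `∑_N e^{-N s} ∑_{a + b = m} F N a s ^ b / b!`. -/
noncomputable def expKernel (m : ℕ) (F : ℕ → ℕ → ℝ≥0∞) (s : ℝ) : ℝ≥0∞ :=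
  ∑' N, ENNReal.ofReal (Real.exp (-s)) ^ N *
    ∑ p ∈ antidiagonal m, F N p.1 * ENNReal.ofReal (s ^ p.2 / p.2.factorial)

/-- The generating function `∑_N x(t) ^ N · nestedSum g l N`. -/
noncomputable def nestedGen (g : ℕ → ℝ≥0∞) (x : ℝ → ℝ≥0∞) (l : List ℕ) (t : ℝ) : ℝ≥0∞ :=
  ∑' N, x t ^ N * nestedSum g l N

/-- A weight `g` whose generating functions at `e^{-t}` and at `x(t)` are `G` and `1 / G`, where
`x' = G x`. -/
structure DualKernel (g : ℕ → ℝ≥0∞) (x G : ℝ → ℝ≥0∞) : Prop where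
  measurable_x : Measurable x
  measurable_G : Measurable G
  g_zero : g 0 = 0
  tsum_exp : ∀ t : ℝ, 0 < t → ∑' d, g d * ENNReal.ofReal (Real.exp (-t)) ^ d = G t
  tsum_x : ∀ t : ℝ, 0 < t → G t * ∑' d, g d * x t ^ d = 1
  lintegral_x : ∀ t : ℝ, 0 < t → ∀ N : ℕ, N ≠ 0 →
    ∫⁻ s in Ioc 0 t, G s * x s ^ N = x t ^ N * (N : ℝ≥0∞)⁻¹

/-! ### Convolutions and coefficients of power series in `y`. -/

theorem ENNReal.tsum_sum_antidiagonal (f : ℕ → ℕ → ℝ≥0∞) :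
    ∑' N, ∑ p ∈ antidiagonal N, f p.1 p.2 = ∑' p, ∑' q, f p q := by
  rw [← ENNReal.tsum_prod (f := f),
    ← Finset.HasAntidiagonal.sigmaAntidiagonalEquivProd.tsum_eq (fun p : ℕ × ℕ => f p.1 p.2),
    ENNReal.tsum_sigma']
  refine tsum_congr fun N => ?_
  rw [tsum_fintype, ← Finset.sum_coe_sort]
  rfl

theorem tsum_mul_cauchyConv (φ : ℕ → ℝ≥0∞) (g F : ℕ → ℝ≥0∞) :
    ∑' N, φ N * cauchyConv g F N = ∑' M, (∑' d, g d * φ (d + M)) * F M := by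
  have h : ∀ N, φ N * cauchyConv g F N =
      ∑ p ∈ antidiagonal N, g p.1 * φ (p.1 + p.2) * F p.2 := by
    intro N
    rw [cauchyConv, Finset.mul_sum]
    refine Finset.sum_congr rfl fun p hp => ?_
    rw [mem_antidiagonal.1 hp]; ring
  simp_rw [h]
  rw [ENNReal.tsum_sum_antidiagonal (fun d M => g d * φ (d + M) * F M), ENNReal.tsum_comm]
  simp_rw [ENNReal.tsum_mul_right]

theorem cauchyConv_zero {g : ℕ → ℝ≥0∞} (hg : g 0 = 0) (F : ℕ → ℝ≥0∞) :
    cauchyConv g F 0 = 0 := by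
  simp [cauchyConv, hg]

/-- The factor `0⁻¹ ^ c` may be `∞`, but `∞ * 0 = 0` and the convolution at 0 vanishes. This
discards the index `N = 0`, where no integral of a power or exponential is available. -/
theorem nestedSum_cons_zero {g : ℕ → ℝ≥0∞} (hg : g 0 = 0) (c : ℕ) (l : List ℕ) :
    nestedSum g (c :: l) 0 = 0 := by
  simp [nestedSum, cauchyConv_zero hg]

theorem nestedSumCoeff_cons_zero {g : ℕ → ℝ≥0∞} (hg : g 0 = 0) (c : ℕ) (l : List ℕ) (a : ℕ) :
    nestedSumCoeff g (c :: l) 0 a = 0 := by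
  simp [nestedSumCoeff, cauchyConv_zero hg]

/-- Associativity of multiplication of formal power series, read off at one coefficient. -/
theorem sum_antidiagonal_assoc (F R S : ℕ → ℝ≥0∞) (m : ℕ) :
    ∑ p ∈ antidiagonal m, F p.1 * ∑ q ∈ antidiagonal p.2, R q.1 * S q.2 =
      ∑ p ∈ antidiagonal m, (∑ q ∈ antidiagonal p.1, F q.1 * R q.2) * S p.2 := by
  have h := congrArg (PowerSeries.coeff m)
    (mul_assoc (PowerSeries.mk F) (PowerSeries.mk R) (PowerSeries.mk S))
  simpa [PowerSeries.coeff_mul, PowerSeries.coeff_mk] using h.symm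

/-- The hockey-stick identity, that is `(1 - y)^{-1} (1 - y)^{-(c+1)} = (1 - y)^{-(c+2)}` on
coefficients. -/
theorem sum_antidiagonal_choose (c a : ℕ) :
    ∑ p ∈ antidiagonal a, (c + 1 + p.1 - 1).choose p.1 = (c + 2 + a - 1).choose a := by
  rw [Finset.Nat.sum_antidiagonal_eq_sum_range_succ_mk]
  have h := Nat.sum_range_add_choose a c
  rw [show c + 2 + a - 1 = a + c + 1 by omega, ← Nat.choose_symm (by omega),
    show a + c + 1 - a = c + 1 by omega, ← h]
  refine Finset.sum_congr rfl fun i _ => ?_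
  rw [← Nat.choose_symm (by omega)]
  congr 1 <;> simp; omega

/-- Multiplication by `1 / (N - y)`. -/
theorem sum_nestedSumCoeff_cons {g : ℕ → ℝ≥0∞} {c : ℕ} (hc : 0 < c) (l : List ℕ) (N a : ℕ) :
    ∑ p ∈ antidiagonal a,
      nestedSumCoeff g (c :: l) N p.1 * (N : ℝ≥0∞)⁻¹ ^ (p.2 + 1) =
        nestedSumCoeff g ((c + 1) :: l) N a := by
  obtain ⟨c, rfl⟩ := Nat.exists_eq_add_of_le' hc
  simp only [nestedSumCoeff]
  rw [← Finset.Nat.sum_antidiagonal_swap]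
  simp only [Prod.fst_swap, Prod.snd_swap]
  -- The three series are `1 / (N - y)`, `1 / (N - y)^{c+1}` and the convolved tail; regrouping
  -- merges the first two.
  have h := sum_antidiagonal_assoc (fun p => (N : ℝ≥0∞)⁻¹ ^ (p + 1))
    (fun p => ((c + 1 + p - 1).choose p : ℝ≥0∞) * (N : ℝ≥0∞)⁻¹ ^ (c + 1 + p))
    (fun p => cauchyConv g (fun M => nestedSumCoeff g l M p) N) a
  simp only [mul_comm (_ ^ (_ + 1) : ℝ≥0∞) (Finset.sum _ _)] at h
  rw [h]
  refine Finset.sum_congr rfl fun p _ => ?_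
  congr 1
  rw [← sum_antidiagonal_choose c p.1, Nat.cast_sum, Finset.sum_mul,
    ← Finset.Nat.sum_antidiagonal_swap]
  refine Finset.sum_congr rfl fun q hq => ?_
  rw [← mem_antidiagonal.1 hq]
  simp only [Prod.fst_swap, Prod.snd_swap]
  rw [mul_left_comm, ← pow_add]
  congr 2; omega

theorem sum_cauchyConv_nestedSumCoeff {g : ℕ → ℝ≥0∞} (l : List ℕ) (N a : ℕ) :
    ∑ p ∈ antidiagonal a,
      cauchyConv g (fun M => nestedSumCoeff g l M p.1) N * (N : ℝ≥0∞)⁻¹ ^ (p.2 + 1) =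
        nestedSumCoeff g (1 :: l) N a := by
  simp only [nestedSumCoeff]
  rw [← Finset.Nat.sum_antidiagonal_swap]
  refine Finset.sum_congr rfl fun p _ => ?_
  simp [mul_comm, add_comm]

/-! ### Integration of exponential kernels over `(s, ∞)`. -/

/-- This is the `y^b` coefficient of `∫_s^∞ e^{-(N-y)t} dt = e^{-(N-y)s} / (N - y)`. -/
theorem lintegral_Ioi_exp_mul_pow (N : ℕ) (hN : N ≠ 0) (b : ℕ) (s : ℝ) (hs : 0 ≤ s) :
    ∫⁻ t in Ioi s, ENNReal.ofReal (Real.exp (-t)) ^ N * ENNReal.ofReal (t ^ b / b.factorial) =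
      ENNReal.ofReal (Real.exp (-s)) ^ N * ∑ p ∈ antidiagonal b,
        (N : ℝ≥0∞)⁻¹ ^ (p.1 + 1) * ENNReal.ofReal (s ^ p.2 / p.2.factorial) := by
  have hN' : (0 : ℝ) < N := by positivity
  set f : ℝ → ℝ := fun t => -(Real.exp (-(N * t)) * ∑ p ∈ antidiagonal b,
    ((N : ℝ)⁻¹ ^ (p.1 + 1) * (t ^ p.2 / p.2.factorial))) with hf
  have hder : ∀ t, HasDerivAt f (Real.exp (-(N * t)) * (t ^ b / b.factorial)) t := by
    intro t
    -- The polynomials `P_n` satisfy `P_n' = N P_n - t^n / n!`; the induction uses `P_{n+1} = N⁻¹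
    -- (t^{n+1} / (n+1)! + P_n)`.
    have h1 : ∀ n : ℕ, HasDerivAt (fun t : ℝ => ∑ p ∈ antidiagonal n,
        ((N : ℝ)⁻¹ ^ (p.1 + 1) * (t ^ p.2 / p.2.factorial)))
        (N * ∑ p ∈ antidiagonal n, ((N : ℝ)⁻¹ ^ (p.1 + 1) * (t ^ p.2 / p.2.factorial))
          - t ^ n / n.factorial) t := by
      intro n
      induction n with
      | zero => 
        have : (N : ℝ) * (N : ℝ)⁻¹ - 1 = 0 := by field_simp; simp
        simpa [this] using hasDerivAt_const t ((N : ℝ)⁻¹)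
      | succ n ih =>
        simp only [Finset.Nat.antidiagonal_succ, Finset.sum_cons, Finset.sum_map,
          Function.Embedding.coeFn_mk, Function.Embedding.prodMap, Prod.map,
          Function.Embedding.refl_apply]
        have h2 := ((hasDerivAt_pow (n + 1) t).div_const ((n + 1).factorial : ℝ)).const_mul
          ((N : ℝ)⁻¹ ^ (0 + 1))
        have h3 := ih.const_mul ((N : ℝ)⁻¹)
        have e : ∀ u : ℝ, ∑ p ∈ antidiagonal n,
            (N : ℝ)⁻¹ ^ (p.1.succ + 1) * (u ^ p.2 / p.2.factorial) =
            (N : ℝ)⁻¹ * ∑ p ∈ antidiagonal n,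
              ((N : ℝ)⁻¹ ^ (p.1 + 1) * (u ^ p.2 / p.2.factorial)) := by
          intro u
          rw [Finset.mul_sum]
          refine Finset.sum_congr rfl fun p _ => ?_
          rw [Nat.succ_eq_add_one, pow_succ' _ (p.1 + 1), mul_assoc]
        refine ((h2.add h3).congr_of_eventuallyEq (.of_forall fun u => ?_)).congr_deriv ?_
        · simp only [Pi.add_apply, e u]
        · have hfac : ((n + 1).factorial : ℝ) = (n + 1) * n.factorial := by
            rw [Nat.factorial_succ]; push_cast; ring
          have hn : (n.factorial : ℝ) ≠ 0 := by positivity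
          rw [e t, hfac, Nat.add_sub_cancel, zero_add, pow_one]
          generalize ∑ p ∈ antidiagonal n, ((N : ℝ)⁻¹ ^ (p.1 + 1) * (t ^ p.2 / p.2.factorial)) = S
          field_simp
          push_cast
          ring
    have h0 : HasDerivAt (fun t : ℝ => Real.exp (-(N * t))) (Real.exp (-(N * t)) * -(N * 1)) t :=
      ((hasDerivAt_id t).const_mul (N : ℝ)).neg.exp
    have := (h0.mul (h1 b)).neg
    refine this.congr_deriv ?_
    ring
  have hlim : Tendsto f atTop (𝓝 0) := by
    rw [hf]
    have : ∀ n : ℕ, Tendsto (fun t : ℝ => t ^ n * Real.exp (-(N * t))) atTop (𝓝 0) := by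
      intro n
      have := tendsto_rpow_mul_exp_neg_mul_atTop_nhds_zero n N hN'
      simpa [neg_mul] using this
    have h2 : Tendsto (fun t : ℝ => -∑ p ∈ antidiagonal b,
      ((N : ℝ)⁻¹ ^ (p.1 + 1) / p.2.factorial) * (t ^ p.2 * Real.exp (-(N * t)))) atTop
        (𝓝 (-∑ p ∈ antidiagonal b, ((N : ℝ)⁻¹ ^ (p.1 + 1) / p.2.factorial) * 0)) :=
      (tendsto_finsetSum _ fun p _ => (this p.2).const_mul _).neg
    simp only [mul_zero, Finset.sum_const_zero, neg_zero] at h2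
    refine h2.congr fun t => ?_
    rw [Finset.mul_sum]
    congr 1
    refine Finset.sum_congr rfl fun p _ => ?_
    ring
  have hpos : ∀ t ∈ Ioi s, 0 ≤ Real.exp (-(N * t)) * (t ^ b / b.factorial) := by
    intro t ht
    have : 0 ≤ t := hs.trans (le_of_lt ht)
    positivity
  have hint := integrableOn_Ioi_deriv_of_nonneg' (fun t _ => hder t) hpos hlim
  have hval := integral_Ioi_of_hasDerivAt_of_nonneg' (fun t _ => hder t) hpos hlim
  have hexp : ∀ t : ℝ, ENNReal.ofReal (Real.exp (-t)) ^ N = ENNReal.ofReal (Real.exp (-(N * t))) := by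
    intro t
    rw [← ENNReal.ofReal_pow (Real.exp_nonneg _), ← Real.exp_nat_mul]
    congr 2; ring
  have hinv : (N : ℝ≥0∞)⁻¹ = ENNReal.ofReal (N : ℝ)⁻¹ := by
    rw [ENNReal.ofReal_inv_of_pos hN', ENNReal.ofReal_natCast]
  simp only [hexp, hinv, ← ENNReal.ofReal_mul (Real.exp_nonneg _)]
  rw [← ofReal_integral_eq_lintegral_ofReal hint
    ((ae_restrict_iff' measurableSet_Ioi).2 (ae_of_all _ hpos)), hval, hf, zero_sub, neg_neg,
    ENNReal.ofReal_mul (Real.exp_nonneg _), ENNReal.ofReal_sum_of_nonneg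
      (fun p _ => by positivity)]
  congr 1
  refine Finset.sum_congr rfl fun p _ => ?_
  rw [ENNReal.ofReal_mul (by positivity), ENNReal.ofReal_pow (by positivity)]

theorem measurable_expKernel (m : ℕ) (F : ℕ → ℕ → ℝ≥0∞) : Measurable (expKernel m F) := by
  unfold expKernel
  fun_prop

theorem DualKernel.measurable_nestedGen {g : ℕ → ℝ≥0∞} {x G : ℝ → ℝ≥0∞} (h : DualKernel g x G)
    (l : List ℕ) : Measurable (nestedGen g x l) := by
  have := h.measurable_x
  unfold nestedGen
  fun_prop

/-- Integration of an exponential kernel. -/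
theorem lintegral_Ioi_expKernel (m : ℕ) (F : ℕ → ℕ → ℝ≥0∞) (hF : ∀ a, F 0 a = 0) (s : ℝ)
    (hs : 0 ≤ s) :
    ∫⁻ t in Ioi s, expKernel m F t = expKernel m (fun N a => ∑ p ∈ antidiagonal a,
      F N p.1 * (N : ℝ≥0∞)⁻¹ ^ (p.2 + 1)) s := by
  unfold expKernel
  rw [lintegral_tsum fun N => by fun_prop]
  refine tsum_congr fun N => ?_
  rcases eq_or_ne N 0 with rfl | hN
  · simp [hF]
  simp_rw [Finset.mul_sum]
  rw [lintegral_finsetSum _ fun p _ => by fun_prop]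
  simp_rw [mul_left_comm _ (F N _)]
  simp_rw [← Finset.mul_sum]
  rw [← sum_antidiagonal_assoc (F N) (fun p => (N : ℝ≥0∞)⁻¹ ^ (p + 1))
    (fun p => ENNReal.ofReal (s ^ p / p.factorial)) m, Finset.mul_sum]
  refine Finset.sum_congr rfl fun p _ => ?_
  rw [lintegral_const_mul _ (by fun_prop), lintegral_Ioi_exp_mul_pow N hN _ s hs]
  ring

/-- Since `G` is itself the exponential series `∑ g_d e^{-ds}`, the product of the two series in
`e^{-s}` is a convolution in `N`; the powers of `s` are untouched. -/
theorem DualKernel.mul_expKernel {g : ℕ → ℝ≥0∞} {x G : ℝ → ℝ≥0∞} (h : DualKernel g x G)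
    (m : ℕ) (F : ℕ → ℕ → ℝ≥0∞) (s : ℝ) (hs : 0 < s) :
    G s * expKernel m F s =
      expKernel m (fun N a => cauchyConv g (fun M => F M a) N) s := by
  unfold expKernel
  have e : ∀ N, ∑ p ∈ antidiagonal m, cauchyConv g (fun M => F M p.1) N *
      ENNReal.ofReal (s ^ p.2 / p.2.factorial) = cauchyConv g (fun M =>
        ∑ p ∈ antidiagonal m, F M p.1 * ENNReal.ofReal (s ^ p.2 / p.2.factorial)) N := by
    intro N
    simp only [cauchyConv, Finset.sum_mul, Finset.mul_sum]
    rw [Finset.sum_comm]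
    simp only [mul_assoc]
  simp_rw [e]
  rw [tsum_mul_cauchyConv, ← ENNReal.tsum_mul_left]
  refine tsum_congr fun M => ?_
  rw [← mul_assoc, ← h.tsum_exp s hs, ← ENNReal.tsum_mul_right]
  simp_rw [pow_add, mul_assoc]

/-- `∫_s^∞ G K_q = K_{1 :: q}`. -/
theorem DualKernel.lintegral_Ioi_mul_expKernel {g : ℕ → ℝ≥0∞} {x G : ℝ → ℝ≥0∞}
    (h : DualKernel g x G) (m : ℕ) (q : List ℕ) (s : ℝ) (hs : 0 ≤ s) :
    ∫⁻ t in Ioi s, G t * expKernel m (nestedSumCoeff g q) t =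
      expKernel m (nestedSumCoeff g (1 :: q)) s := by
  rw [setLIntegral_congr_fun measurableSet_Ioi
    (fun t ht => h.mul_expKernel m (nestedSumCoeff g q) t (hs.trans_lt ht)),
    lintegral_Ioi_expKernel _ _ (fun a => cauchyConv_zero h.g_zero _) s hs]
  simp_rw [sum_cauchyConv_nestedSumCoeff]

/-- `∫_s^∞ K_q = K_{plusOne q}`. -/
theorem DualKernel.lintegral_Ioi_expKernel {g : ℕ → ℝ≥0∞} {x G : ℝ → ℝ≥0∞}
    (h : DualKernel g x G) (m : ℕ) {q : List ℕ} (hq : IsComposition q) (s : ℝ) (hs : 0 ≤ s) :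
    ∫⁻ t in Ioi s, expKernel m (nestedSumCoeff g q) t =
      expKernel m (nestedSumCoeff g (plusOne q)) s := by
  obtain ⟨h1, h2⟩ := hq
  cases q with
  | nil => exact absurd rfl h1
  | cons c l =>
    rw [_root_.lintegral_Ioi_expKernel _ _ (fun a => nestedSumCoeff_cons_zero h.g_zero _ _ _) s hs]
    simp_rw [sum_nestedSumCoeff_cons (h2 c (by simp)), plusOne]

/-! ### Generating functions as iterated integrals, and the duality. -/

theorem DualKernel.nestedGen_succ_cons {g : ℕ → ℝ≥0∞} {x G : ℝ → ℝ≥0∞} (h : DualKernel g x G)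
    (c : ℕ) (l : List ℕ) (t : ℝ) (ht : 0 < t) :
    nestedGen g x ((c + 1) :: l) t = ∫⁻ s in Ioc 0 t, G s * nestedGen g x (c :: l) s := by
  have := h.measurable_x
  have := h.measurable_G
  unfold nestedGen
  simp_rw [← ENNReal.tsum_mul_left]
  rw [lintegral_tsum fun N => by fun_prop]
  refine tsum_congr fun N => ?_
  rcases eq_or_ne N 0 with rfl | hN
  · simp [nestedSum_cons_zero h.g_zero]
  simp_rw [← mul_assoc]
  rw [lintegral_mul_const _ (by fun_prop), h.lintegral_x t ht N hN]
  simp only [nestedSum, pow_succ]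
  ring

/-- Because `G ∑ g_d x^d = 1`, each `x^M` equals `∑_d g_d G x^{d+M}`. Integrating this termwise
restores both the convolution with `g` and the factor `1 / N`. -/
theorem DualKernel.nestedGen_one_cons {g : ℕ → ℝ≥0∞} {x G : ℝ → ℝ≥0∞} (h : DualKernel g x G)
    (l : List ℕ) (t : ℝ) (ht : 0 < t) :
    nestedGen g x (1 :: l) t = ∫⁻ s in Ioc 0 t, nestedGen g x l s := by
  have := h.measurable_x
  have := h.measurable_G
  unfold nestedGen
  rw [lintegral_tsum fun N => by fun_prop]
  simp only [nestedSum, pow_one, ← mul_assoc]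
  rw [tsum_mul_cauchyConv]
  refine tsum_congr fun M => ?_
  rw [lintegral_mul_const _ (by fun_prop)]
  congr 1
  have e : ∀ s ∈ Ioc 0 t, x s ^ M = ∑' d, g d * (G s * x s ^ (d + M)) := by
    intro s hs
    calc x s ^ M = (G s * ∑' d, g d * x s ^ d) * x s ^ M := by rw [h.tsum_x s hs.1, one_mul]
      _ = _ := by
        rw [← ENNReal.tsum_mul_left, ← ENNReal.tsum_mul_right]
        refine tsum_congr fun d => ?_
        rw [pow_add]; ring
  rw [setLIntegral_congr_fun measurableSet_Ioc e, lintegral_tsum fun N => by fun_prop]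
  refine tsum_congr fun d => ?_
  rcases eq_or_ne d 0 with rfl | hd
  · simp [h.g_zero]
  rw [lintegral_const_mul _ (by fun_prop), h.lintegral_x t ht _ (by omega)]

/-- Tonelli on the triangle `0 < s ≤ t`. It transfers one integration from the generating function
to the kernel. -/
theorem lintegral_Ioi_mul_lintegral_Ioc {h f : ℝ → ℝ≥0∞} (hh : Measurable h) (hf : Measurable f) :
    ∫⁻ t in Ioi (0 : ℝ), h t * ∫⁻ s in Ioc 0 t, f s =
      ∫⁻ s in Ioi (0 : ℝ), (∫⁻ t in Ioi s, h t) * f s := by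
  have hS : MeasurableSet {p : ℝ × ℝ | p.2 ≤ p.1} := measurableSet_le measurable_snd measurable_fst
  have e1 : ∀ t ∈ Ioi (0 : ℝ), h t * ∫⁻ s in Ioc 0 t, f s =
      ∫⁻ s in Ioi (0 : ℝ), {p : ℝ × ℝ | p.2 ≤ p.1}.indicator (fun p => h p.1 * f p.2) (t, s) := by
    intro t _
    rw [← lintegral_const_mul _ hf, ← Ioi_inter_Iic, inter_comm,
      ← Measure.restrict_restrict measurableSet_Iic, ← lintegral_indicator measurableSet_Iic]
    rfl
  have e2 : ∀ s ∈ Ioi (0 : ℝ), (∫⁻ t in Ioi s, h t) * f s =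
      ∫⁻ t in Ioi (0 : ℝ), {p : ℝ × ℝ | p.2 ≤ p.1}.indicator (fun p => h p.1 * f p.2) (t, s) := by
    intro s hs
    have : Ici s ∩ Ioi 0 = Ici s := inter_eq_left.2 fun u hu => mem_Ioi.2 (lt_of_lt_of_le (mem_Ioi.1 hs) hu)
    rw [← lintegral_mul_const _ hh, setLIntegral_congr Ioi_ae_eq_Ici, ← this,
      ← Measure.restrict_restrict measurableSet_Ici, ← lintegral_indicator measurableSet_Ici]
    rfl
  rw [setLIntegral_congr_fun measurableSet_Ioi e1, setLIntegral_congr_fun measurableSet_Ioi e2]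
  exact lintegral_lintegral_swap
    (((hh.comp measurable_fst).mul (hf.comp measurable_snd)).indicator hS).aemeasurable

/-- Integrating `G K_q` against a generating function. -/
theorem DualKernel.lintegral_mul_expKernel_mul_nestedGen {g : ℕ → ℝ≥0∞} {x G : ℝ → ℝ≥0∞}
    (h : DualKernel g x G) (m : ℕ) (l : List ℕ) (c : ℕ) (q : List ℕ) :
    ∫⁻ t in Ioi (0 : ℝ), (G t * expKernel m (nestedSumCoeff g q) t) *
        nestedGen g x ((c + 1) :: l) t =
      ∫⁻ t in Ioi (0 : ℝ), expKernel m (nestedSumCoeff g (List.replicate (c + 1) 1 ++ q)) t *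
        nestedGen g x l t := by
  have hG := h.measurable_G
  have hK := fun q => measurable_expKernel m (nestedSumCoeff g q)
  have hL := h.measurable_nestedGen
  induction c generalizing q with
  | zero =>
    rw [setLIntegral_congr_fun measurableSet_Ioi
      (fun t ht => by rw [zero_add, h.nestedGen_one_cons l t ht]),
      lintegral_Ioi_mul_lintegral_Ioc (h := fun t => G t * _) (hG.mul (hK q)) (hL l)]
    refine setLIntegral_congr_fun measurableSet_Ioi fun t ht => ?_
    rw [h.lintegral_Ioi_mul_expKernel m q t (le_of_lt ht)]
    rfl
  | succ c ih =>
    rw [setLIntegral_congr_fun measurableSet_Ioi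
      (fun t ht => by rw [h.nestedGen_succ_cons _ l t ht]),
      lintegral_Ioi_mul_lintegral_Ioc (h := fun t => G t * _) (f := fun t => G t * _)
        (hG.mul (hK q)) (hG.mul (hL _))]
    -- The 1 created by this transfer belongs next to `q`; the later ones go in front of it.
    rw [show List.replicate (c + 1 + 1) 1 ++ q = List.replicate (c + 1) 1 ++ (1 :: q) by
      rw [List.replicate_succ' (n := c + 1)]; simp, ← ih (1 :: q)]
    refine setLIntegral_congr_fun measurableSet_Ioi fun t ht => ?_
    rw [h.lintegral_Ioi_mul_expKernel m q t (le_of_lt ht)]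
    ring

/-- Integrating `K_q` against a generating function. -/
theorem DualKernel.lintegral_expKernel_mul_nestedGen {g : ℕ → ℝ≥0∞} {x G : ℝ → ℝ≥0∞}
    (h : DualKernel g x G) (m : ℕ) (l : List ℕ) {c : ℕ} (hc : 0 < c) {q : List ℕ}
    (hq : IsComposition q) :
    ∫⁻ t in Ioi (0 : ℝ), expKernel m (nestedSumCoeff g q) t * nestedGen g x (c :: l) t =
      ∫⁻ t in Ioi (0 : ℝ), expKernel m (nestedSumCoeff g
        (List.replicate (c - 1) 1 ++ plusOne q)) t * nestedGen g x l t := by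
  have hG := h.measurable_G
  have hK := fun q => measurable_expKernel m (nestedSumCoeff g q)
  have hL := h.measurable_nestedGen
  obtain ⟨c, rfl⟩ := Nat.exists_eq_add_of_le' hc
  rcases c with _ | c
  · rw [setLIntegral_congr_fun measurableSet_Ioi
      (fun t ht => by rw [zero_add, h.nestedGen_one_cons l t ht]),
      lintegral_Ioi_mul_lintegral_Ioc (hK q) (hL l)]
    refine setLIntegral_congr_fun measurableSet_Ioi fun t ht => ?_
    rw [h.lintegral_Ioi_expKernel m hq t (le_of_lt ht)]
    rfl
  · rw [setLIntegral_congr_fun measurableSet_Ioi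
      (fun t ht => by rw [h.nestedGen_succ_cons _ l t ht]),
      lintegral_Ioi_mul_lintegral_Ioc (f := fun t => G t * _) (hK q) (hG.mul (hL _)), Nat.add_sub_cancel,
      ← h.lintegral_mul_expKernel_mul_nestedGen]
    refine setLIntegral_congr_fun measurableSet_Ioi fun t ht => ?_
    rw [h.lintegral_Ioi_expKernel m hq t (le_of_lt ht)]
    ring

theorem nestedGen_nil (g : ℕ → ℝ≥0∞) (x : ℝ → ℝ≥0∞) (t : ℝ) : nestedGen g x [] t = 1 := by
  unfold nestedGen
  rw [tsum_eq_single 0 (fun N hN => by simp [nestedSum, hN])]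
  simp [nestedSum]

/-- At `s = 0` only the power `s^0` survives, so the full `y^m` coefficient of `F` is extracted. -/
theorem expKernel_zero (m : ℕ) (F : ℕ → ℕ → ℝ≥0∞) : expKernel m F 0 = ∑' N, F N m := by
  unfold expKernel
  refine tsum_congr fun N => ?_
  rw [Finset.sum_eq_single (m, 0)]
  · simp
  · rintro ⟨a, b⟩ hp hne
    have : b ≠ 0 := by
      rintro rfl
      exact hne (by simpa using hp)
    simp [this]
  · simp

theorem expKernel_nestedSumCoeff_nil (g : ℕ → ℝ≥0∞) (m : ℕ) (s : ℝ) :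
    expKernel m (nestedSumCoeff g []) s = ENNReal.ofReal (s ^ m / m.factorial) := by
  unfold expKernel
  rw [tsum_eq_single 0 (fun N hN => by simp [nestedSumCoeff, hN]), Finset.sum_eq_single (0, m)]
  · simp [nestedSumCoeff]
  · rintro ⟨a, b⟩ hp hne
    have : a ≠ 0 := by
      rintro rfl
      exact hne (by simpa using hp)
    simp [nestedSumCoeff, this]
  · simp

/-- Here `p` holds the entries already transferred, in reverse order, and `l` the remaining ones.
Transferring the head `c` turns the dual of `p` into `replicate (c - 1) 1 ++ plusOne (hoffmanDual
p)`, which is exactly the recursion for the dual of `c :: p`. -/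
theorem DualKernel.lintegral_expKernel_hoffmanDual {g : ℕ → ℝ≥0∞} {x G : ℝ → ℝ≥0∞}
    (h : DualKernel g x G) (m : ℕ) (l : List ℕ) (hl : ∀ a ∈ l, 0 < a) (p : List ℕ)
    (hp : IsComposition p) :
    ∫⁻ t in Ioi (0 : ℝ), expKernel m (nestedSumCoeff g (hoffmanDual p)) t * nestedGen g x l t =
      ∑' N, nestedSumCoeff g (plusOne (hoffmanDual (l.reverse ++ p))) N m := by
  induction l generalizing p with
  | nil =>
    simp only [nestedGen_nil, mul_one, List.reverse_nil, List.nil_append]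
    rw [h.lintegral_Ioi_expKernel m (hoffmanDual_isComposition hp) 0 le_rfl, expKernel_zero]
  | cons c l ih =>
    have hc : 0 < c := hl c (by simp)
    rw [h.lintegral_expKernel_mul_nestedGen m l hc (hoffmanDual_isComposition hp)]
    have := ih (fun a ha => hl a (List.mem_cons_of_mem _ ha)) (c :: p)
      ⟨by simp, fun a ha => (List.mem_cons.1 ha).elim (fun e => e ▸ hc) (hp.2 a)⟩
    obtain ⟨b, p, rfl⟩ := List.exists_cons_of_ne_nil hp.1
    rw [hoffmanDual] at this
    rw [this]
    simp

/-- Duality for the integral of `G(t) t ^ m / m!` against a generating function. -/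
theorem DualKernel.lintegral_nestedGen {g : ℕ → ℝ≥0∞} {x G : ℝ → ℝ≥0∞}
    (h : DualKernel g x G) (m : ℕ) {k : List ℕ} (hk : IsComposition k) :
    ∫⁻ t in Ioi (0 : ℝ), G t * ENNReal.ofReal (t ^ m / m.factorial) * nestedGen g x k t =
      ∑' N, nestedSumCoeff g (plusOne (hoffmanDual k.reverse)) N m := by
  obtain ⟨c, l, rfl⟩ := List.exists_cons_of_ne_nil hk.1
  have hc : 0 < c := hk.2 c (by simp)
  obtain ⟨c, rfl⟩ := Nat.exists_eq_add_of_le' hc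
  -- The leading entry starts from `G K_[]` with `K_[] = t^m / m!`. The factor `G` makes it yield a
  -- full block of `c + 1` ones, the dual of the one-entry list.
  have h1 := h.lintegral_mul_expKernel_mul_nestedGen m l c []
  simp only [expKernel_nestedSumCoeff_nil] at h1
  rw [h1, List.append_nil, show List.replicate (c + 1) 1 = hoffmanDual [c + 1] from rfl,
    h.lintegral_expKernel_hoffmanDual m l (fun a ha => hk.2 a (List.mem_cons_of_mem _ ha)) [c + 1]
      ⟨by simp, by simp⟩]
  simp

/-! ### Binomial expansion of the coefficients. -/

theorem sum_antidiagonalTuple_succ {M : Type*} [AddCommMonoid M] (n m : ℕ)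
    (f : (Fin (n + 1) → ℕ) → M) :
    ∑ j ∈ Finset.Nat.antidiagonalTuple (n + 1) m, f j =
      ∑ p ∈ antidiagonal m, ∑ j ∈ Finset.Nat.antidiagonalTuple n p.2, f (Fin.cons p.1 j) := by
  rw [Finset.sum_sigma']
  symm
  refine Finset.sum_bij' (fun a _ => Fin.cons a.1.1 a.2)
    (fun j _ => ⟨(j 0, ∑ i, Fin.tail j i), Fin.tail j⟩) ?_ ?_ ?_ ?_ ?_
  · rintro ⟨⟨a, b⟩, j⟩ h
    simp only [Finset.mem_sigma, mem_antidiagonal, Finset.Nat.mem_antidiagonalTuple] at h ⊢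
    rw [Fin.sum_cons, h.2, h.1]
  · intro j h
    simp only [Finset.mem_sigma, mem_antidiagonal, Finset.Nat.mem_antidiagonalTuple] at h ⊢
    rw [Fin.sum_univ_succ] at h
    exact ⟨h, trivial⟩
  · rintro ⟨⟨a, b⟩, j⟩ h
    simp only [Finset.mem_sigma, mem_antidiagonal, Finset.Nat.mem_antidiagonalTuple] at h
    simp [h.2]
  · intro j _
    simp
  · intros
    rfl

/-- Expansion of `nestedSumCoeff` in terms of nested sums. -/
theorem nestedSumCoeff_eq_sum (g : ℕ → ℝ≥0∞) {n : ℕ} (q : List ℕ) (hn : q.length = n) (N m : ℕ) :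
    nestedSumCoeff g q N m = ∑ j ∈ Finset.Nat.antidiagonalTuple n m,
      (multiBinom q (List.ofFn j) : ℝ≥0∞) * nestedSum g (addComp q (List.ofFn j)) N := by
  induction q generalizing n N m with
  | nil =>
    obtain rfl : n = 0 := hn.symm
    rcases m with _ | m <;> simp [nestedSumCoeff, multiBinom, addComp, nestedSum]
  | cons c q ih =>
    obtain rfl : n = q.length + 1 := hn.symm
    rw [sum_antidiagonalTuple_succ, nestedSumCoeff]
    refine Finset.sum_congr rfl fun p _ => ?_
    have e : cauchyConv g (fun M => nestedSumCoeff g q M p.2) N =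
        ∑ j ∈ Finset.Nat.antidiagonalTuple q.length p.2, (multiBinom q (List.ofFn j) : ℝ≥0∞) *
          cauchyConv g (nestedSum g (addComp q (List.ofFn j))) N := by
      simp only [cauchyConv, fun M => ih rfl M p.2, Finset.mul_sum]
      rw [Finset.sum_comm]
      refine Finset.sum_congr rfl fun j _ => Finset.sum_congr rfl fun r _ => ?_
      ring
    rw [e, Finset.mul_sum]
    refine Finset.sum_congr rfl fun j _ => ?_
    simp only [multiBinom, addComp, List.ofFn_cons, List.zipWith_cons_cons, List.prod_cons,
      nestedSum, Nat.cast_mul]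
    ring

/-! ### Sums over decreasing tuples as nested sums over gaps. -/

/-- The first entry of a tuple, and `0` for the empty tuple. -/
def headEntry {r : ℕ} (n : Fin r → ℕ) : ℕ :=
  if h : 0 < r then n ⟨0, h⟩ else 0

theorem headEntry_cons {r : ℕ} (N : ℕ) (n : Fin r → ℕ) :
    headEntry (Fin.cons N n : Fin (r + 1) → ℕ) = N := by
  simp only [headEntry, Nat.succ_pos, dif_pos]
  rfl

/-- Truncated subtraction does no harm: for `M ≥ N` the gap reads as 0, where `g` vanishes. -/
theorem cauchyConv_eq_tsum {g : ℕ → ℝ≥0∞} (hg : g 0 = 0) (F : ℕ → ℝ≥0∞) (N : ℕ) :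
    cauchyConv g F N = ∑' M, g (N - M) * F M := by
  rw [cauchyConv, ← Finset.Nat.sum_antidiagonal_swap,
    Finset.Nat.sum_antidiagonal_eq_sum_range_succ_mk, tsum_eq_sum]
  · rfl
  · intro M hM
    rw [Finset.mem_range, not_lt] at hM
    rw [Nat.sub_eq_zero_of_le (by omega), hg, zero_mul]

/-- Sums over tuples whose weight is the product of `g (nᵢ - nᵢ₊₁)` are nested sums. -/
theorem tsum_tuple_eq {g : ℕ → ℝ≥0∞} (hg : g 0 = 0) (V : (r : ℕ) → (Fin r → ℕ) → ℝ≥0∞)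
    (hV0 : ∀ n, V 0 n = 1)
    (hV : ∀ r N n, V (r + 1) (Fin.cons N n) = V r n * g (N - headEntry n)) (l : List ℕ)
    (φ : ℕ → ℝ≥0∞) :
    ∑' n : Fin l.length → ℕ, V l.length n * φ (headEntry n) *
      ∏ i, (n i : ℝ≥0∞)⁻¹ ^ l.get i = ∑' N, φ N * nestedSum g l N := by
  induction l generalizing φ with
  | nil =>
    rw [tsum_eq_single (0 : ℕ) (f := fun N => φ N * nestedSum g [] N)
      (fun N hN => by simp [nestedSum, hN])]
    refine (tsum_eq_single (fun i : Fin 0 => (0 : ℕ))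
      (fun n hn => absurd (Subsingleton.elim (α := Fin 0 → ℕ) _ _) hn)).trans ?_
    simp only [List.length_nil, hV0]
    simp [headEntry, nestedSum]
  | cons c l ih =>
    refine ((Fin.consEquiv fun _ : Fin (l.length + 1) => ℕ).tsum_eq _).symm.trans ?_
    rw [ENNReal.tsum_prod']
    refine tsum_congr fun N => ?_
    -- The function `φ` is kept general so that the gap weight between `N` and the next index can
    -- take its place.
    rw [nestedSum, cauchyConv_eq_tsum hg, ← ih fun M => g (N - M), ← mul_assoc,
      ← ENNReal.tsum_mul_left]
    refine tsum_congr fun n => ?_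
    change V (l.length + 1) (Fin.cons N n) * φ (headEntry (Fin.cons N n : Fin (l.length + 1) → ℕ)) *
      ∏ i : Fin (l.length + 1), ((Fin.cons N n : Fin (l.length + 1) → ℕ) i : ℝ≥0∞)⁻¹ ^
        (c :: l).get i = _
    rw [hV, headEntry_cons, Fin.prod_univ_succ]
    simp only [Fin.cons_zero, Fin.cons_succ, List.get_eq_getElem, Fin.val_zero, Fin.val_succ,
      List.getElem_cons_zero, List.getElem_cons_succ]
    ring

/-- The weight of gaps for sums over all decreasing tuples. -/
noncomputable def gapWeight (d : ℕ) : ℝ≥0∞ := if d = 0 then 0 else 1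

/-- The weight of gaps for sums over decreasing tuples with alternating parities. -/
noncomputable def oddGapWeight (d : ℕ) : ℝ≥0∞ := if Odd d then 2 else 0

theorem gapWeight_zero : gapWeight 0 = 0 := by simp [gapWeight]

theorem oddGapWeight_zero : oddGapWeight 0 = 0 := by simp [oddGapWeight]

theorem gapWeight_le (d : ℕ) : gapWeight d ≤ 2 := by
  unfold gapWeight; split_ifs <;> norm_num

theorem oddGapWeight_le (d : ℕ) : oddGapWeight d ≤ 2 := by
  unfold oddGapWeight; split_ifs <;> norm_num

theorem strictAnti_cons_iff {r : ℕ} (N : ℕ) (n : Fin r → ℕ) :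
    (StrictAnti (Fin.cons N n : Fin (r + 1) → ℕ) ∧ ∀ i, 0 < (Fin.cons N n : Fin (r + 1) → ℕ) i) ↔
      (StrictAnti n ∧ ∀ i, 0 < n i) ∧ headEntry n < N := by
  rw [Fin.forall_fin_succ]
  simp only [Fin.cons_zero, Fin.cons_succ]
  rcases r with _ | r
  · have h1 : StrictAnti n := Subsingleton.strictAnti _
    have h2 : StrictAnti (Fin.cons N n : Fin (0 + 1) → ℕ) := Subsingleton.strictAnti (α := Fin 1) _
    simp [h1, h2, headEntry]
  · have : StrictAnti (Fin.cons N n : Fin (r + 1 + 1) → ℕ) ↔ n 0 < N ∧ StrictAnti n :=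
      strictAnti_vecCons
    have h0 : headEntry n = n 0 := by simp [headEntry]
    rw [this, h0]
    constructor
    · rintro ⟨⟨h1, h2⟩, h3, h4⟩
      exact ⟨⟨h2, h4⟩, h1⟩
    · rintro ⟨⟨h2, h4⟩, h1⟩
      exact ⟨⟨h1, h2⟩, by omega, h4⟩

theorem parity_cons_iff {r : ℕ} (N : ℕ) (n : Fin r → ℕ) :
    (∀ i : Fin (r + 1), (Fin.cons N n : Fin (r + 1) → ℕ) i ≡ r + 1 - (i : ℕ) [MOD 2]) ↔
      (∀ i : Fin r, n i ≡ r - (i : ℕ) [MOD 2]) ∧ N ≡ r + 1 [MOD 2] := by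
  rw [Fin.forall_fin_succ]
  simp [and_comm]

theorem headEntry_parity {r : ℕ} {n : Fin r → ℕ} (h : ∀ i : Fin r, n i ≡ r - (i : ℕ) [MOD 2]) :
    headEntry n ≡ r [MOD 2] := by
  unfold headEntry
  split_ifs with hr
  · simpa using h ⟨0, hr⟩
  · obtain rfl : r = 0 := by omega
    rfl

open Classical in
theorem tsum_decTuple (k : List ℕ) (φ : ℕ → ℝ≥0∞) :
    ∑' n : DecTuple k.length, φ (headEntry n.1) * ∏ i, (n.1 i : ℝ≥0∞)⁻¹ ^ k.get i =
      ∑' N, φ N * nestedSum gapWeight k N := by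
  rw [← tsum_tuple_eq gapWeight_zero
    (fun r n => if StrictAnti n ∧ ∀ i, 0 < n i then 1 else 0) ?_ ?_]
  · refine (tsum_subtype {n : Fin k.length → ℕ | StrictAnti n ∧ ∀ i, 0 < n i}
      (fun n => φ (headEntry n) * ∏ i, (n i : ℝ≥0∞)⁻¹ ^ k.get i)).trans (tsum_congr fun n => ?_)
    simp only [Set.indicator, mem_ofPred_eq]
    split_ifs <;> simp
  · intro n
    rw [if_pos ⟨Subsingleton.strictAnti _, fun i => i.elim0⟩]
  · intro r N n
    simp only [strictAnti_cons_iff, gapWeight, Nat.sub_eq_zero_iff_le, ← not_lt]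
    by_cases h1 : StrictAnti n ∧ ∀ i, 0 < n i <;> by_cases h2 : headEntry n < N <;> simp [h1, h2]

open Classical in
theorem tsum_parityTuple (k : List ℕ) (φ : ℕ → ℝ≥0∞) :
    ∑' n : ParityTuple k.length, 2 ^ k.length *
        (φ (headEntry n.1) * ∏ i, (n.1 i : ℝ≥0∞)⁻¹ ^ k.get i) =
      ∑' N, φ N * nestedSum oddGapWeight k N := by
  rw [← tsum_tuple_eq oddGapWeight_zero (fun r n => if StrictAnti n ∧ (∀ i, 0 < n i) ∧
    ∀ i : Fin r, n i ≡ r - (i : ℕ) [MOD 2] then 2 ^ r else 0) ?_ ?_]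
  · refine (tsum_subtype {n : Fin k.length → ℕ | StrictAnti n ∧ (∀ i, 0 < n i) ∧
      ∀ i, n i ≡ k.length - (i : ℕ) [MOD 2]}
      (fun n => 2 ^ k.length * (φ (headEntry n) * ∏ i, (n i : ℝ≥0∞)⁻¹ ^ k.get i))).trans
        (tsum_congr fun n => ?_)
    simp only [Set.indicator, mem_ofPred_eq]
    split_ifs <;> simp [mul_assoc]
  · intro n
    rw [if_pos ⟨Subsingleton.strictAnti _, fun i => i.elim0, fun i => i.elim0⟩, pow_zero]
  · intro r N n
    simp only [← and_assoc, strictAnti_cons_iff, parity_cons_iff]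
    by_cases h1 : StrictAnti n ∧ ∀ i, 0 < n i
    swap
    · simp [h1]
    by_cases h2 : ∀ i : Fin r, n i ≡ r - (i : ℕ) [MOD 2]
    swap
    · simp [h2]
    have h3 := headEntry_parity h2
    -- The head of the tail is congruent to `r`, so order and parity of the new entry together say
    -- that the new gap is odd. The factor `2 ^ r` is then one 2 per gap.
    have h4 : (headEntry n < N ∧ N ≡ r + 1 [MOD 2]) ↔ Odd (N - headEntry n) := by
      rw [Nat.odd_iff]
      unfold Nat.ModEq at *
      omega
    have h5 : (StrictAnti n ∧ ∀ i, 0 < n i) ↔ True := iff_true_intro h1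
    have h6 : (∀ i : Fin r, n i ≡ r - (i : ℕ) [MOD 2]) ↔ True := iff_true_intro h2
    simp only [h5, h6, true_and, and_true, if_true, oddGapWeight, ← h4]
    split_ifs <;> simp [pow_succ]

/-! ### Finiteness -/

theorem cauchyConv_le {g : ℕ → ℝ≥0∞} (hg : g 0 = 0) (hg2 : ∀ d, g d ≤ 2) (F : ℕ → ℝ≥0∞) (N : ℕ) :
    cauchyConv g F N ≤ 2 * ∑ M ∈ Finset.range N, F M := by
  rw [cauchyConv, ← Finset.Nat.sum_antidiagonal_swap,
    Finset.Nat.sum_antidiagonal_eq_sum_range_succ_mk, Finset.sum_range_succ, Finset.mul_sum]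
  simp only [Prod.fst_swap, Prod.snd_swap, Nat.sub_self, hg, zero_mul, add_zero]
  exact Finset.sum_le_sum fun M _ => mul_le_mul_left (hg2 _) _

theorem nestedSum_cons_le {g : ℕ → ℝ≥0∞} {l : List ℕ}
    (hg : g 0 = 0) (hg2 : ∀ d, g d ≤ 2) {C : ℝ}
    (h : ∀ N : ℕ, 0 < N → ∑ M ∈ Finset.range N, nestedSum g l M ≤ ENNReal.ofReal (C * √N))
    (c N : ℕ) (hN : 0 < N) :
    nestedSum g (c :: l) N ≤ ENNReal.ofReal (2 * C * (√N / N ^ c)) := by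
  have hN' : (0 : ℝ) < N := by exact_mod_cast hN
  rw [nestedSum]
  calc (N : ℝ≥0∞)⁻¹ ^ c * cauchyConv g (nestedSum g l) N
      ≤ (N : ℝ≥0∞)⁻¹ ^ c * (2 * ENNReal.ofReal (C * √N)) := by
        gcongr
        exact (cauchyConv_le hg hg2 _ _).trans (by gcongr; exact h N hN)
    _ = _ := by
        rw [← ENNReal.ofReal_natCast N, ← ENNReal.ofReal_inv_of_pos hN',
          ← ENNReal.ofReal_pow (by positivity), show (2 : ℝ≥0∞) = ENNReal.ofReal 2 by simp,
          ← ENNReal.ofReal_mul (by positivity), ← ENNReal.ofReal_mul (by positivity)]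
        congr 1
        rw [inv_pow]
        ring

/-- The true growth is at most a power of a logarithm; `√N` is a cruder bound that reproduces
itself, since the next layer adds terms of order `1 / √N`, whose sums are again of order `√N`. -/
theorem exists_sum_nestedSum_le {g : ℕ → ℝ≥0∞} (hg : g 0 = 0) (hg2 : ∀ d, g d ≤ 2) (l : List ℕ)
    (hl : ∀ a ∈ l, 0 < a) : ∃ C : ℝ, 0 ≤ C ∧ ∀ N : ℕ, 0 < N →
      ∑ M ∈ Finset.range N, nestedSum g l M ≤ ENNReal.ofReal (C * √N) := by
  induction l with
  | nil =>
    refine ⟨1, zero_le_one, fun N hN => ?_⟩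
    simp only [nestedSum, Finset.sum_ite_eq', Finset.mem_range, hN, if_true, one_mul]
    rw [ENNReal.one_le_ofReal, Real.one_le_sqrt]
    exact_mod_cast hN
  | cons c l ih =>
    obtain ⟨C, hC, h⟩ := ih fun a ha => hl a (List.mem_cons_of_mem _ ha)
    have hc := hl c (by simp)
    -- The factor 6 is 2 from the bound on `g` times 3 from `1 / √N ≤ 3 (√(N+1) - √N)`.
    refine ⟨6 * C, by positivity, fun N hN => ?_⟩
    induction N, hN using Nat.le_induction with
    | base => simp [nestedSum_cons_zero hg]
    | succ N hN ihN =>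
      rw [Finset.sum_range_succ]
      refine (add_le_add ihN (nestedSum_cons_le hg hg2 h c N hN)).trans ?_
      rw [← ENNReal.ofReal_add (by positivity) (by positivity)]
      apply ENNReal.ofReal_le_ofReal
      have h1 : (1 : ℝ) ≤ N := by exact_mod_cast hN
      have hpow : (N : ℝ) ≤ N ^ c := le_self_pow₀ h1 hc.ne'
      have h2 : √(N : ℝ) / N ^ c ≤ 1 / √N := by
        rw [div_le_div_iff₀ (by positivity) (by positivity), Real.mul_self_sqrt (by positivity)]
        linarith
      have h3 : 1 / √(N : ℝ) ≤ 3 * (√((N + 1 : ℕ) : ℝ) - √N) := by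
        have hs : 0 < √(N : ℝ) := by positivity
        have hs1 : √((N + 1 : ℕ) : ℝ) ≤ 2 * √N := by
          rw [Real.sqrt_le_left (by positivity), mul_pow, Real.sq_sqrt (by positivity)]
          push_cast; linarith
        have hsub : (√((N + 1 : ℕ) : ℝ) - √N) * (√((N + 1 : ℕ) : ℝ) + √N) = 1 := by
          have a1 := Real.mul_self_sqrt (show (0 : ℝ) ≤ ((N + 1 : ℕ) : ℝ) by positivity)
          have a2 := Real.mul_self_sqrt (show (0 : ℝ) ≤ N by positivity)
          push_cast at a1 ⊢
          linarith
        have hd : 0 ≤ √((N + 1 : ℕ) : ℝ) - √N :=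
          sub_nonneg.2 (Real.sqrt_le_sqrt (by push_cast; linarith))
        rw [div_le_iff₀ hs]
        nlinarith
      nlinarith [mul_le_mul_of_nonneg_left (h2.trans h3) hC]

/-- A leading exponent of at least 2 against the growth `√N` leaves terms `O(N^{-3/2})`. -/
theorem tsum_nestedSum_ne_top {g : ℕ → ℝ≥0∞} (hg : g 0 = 0) (hg2 : ∀ d, g d ≤ 2) {c : ℕ}
    (hc : 2 ≤ c) (l : List ℕ) (hl : ∀ a ∈ l, 0 < a) : ∑' N, nestedSum g (c :: l) N ≠ ∞ := by
  obtain ⟨C, hC, h⟩ := exists_sum_nestedSum_le hg hg2 l hl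
  have hs : Summable fun N : ℕ => 2 * C * (N : ℝ) ^ (-(3 / 2) : ℝ) :=
    (Real.summable_nat_rpow.2 (by norm_num)).mul_left _
  refine ne_top_of_le_ne_top hs.tsum_ofReal_ne_top (ENNReal.tsum_le_tsum fun N => ?_)
  rcases Nat.eq_zero_or_pos N with rfl | hN
  · simp [nestedSum_cons_zero hg]
  refine (nestedSum_cons_le hg hg2 h c N hN).trans (ENNReal.ofReal_le_ofReal ?_)
  have h1 : (1 : ℝ) ≤ N := by exact_mod_cast hN
  gcongr
  rw [Real.sqrt_eq_rpow, ← Real.rpow_natCast, ← Real.rpow_sub (by positivity)]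
  refine Real.rpow_le_rpow_of_exponent_le h1 ?_
  have : (2 : ℝ) ≤ c := by exact_mod_cast hc
  linarith

theorem tsum_pow_mul_nestedSum_ne_top {g : ℕ → ℝ≥0∞} (hg : g 0 = 0) (hg2 : ∀ d, g d ≤ 2)
    {k : List ℕ} (hk : IsComposition k) {x : ℝ} (hx : 0 ≤ x) (hx1 : x < 1) :
    ∑' N, ENNReal.ofReal x ^ N * nestedSum g k N ≠ ∞ := by
  obtain ⟨c, l, rfl⟩ := List.exists_cons_of_ne_nil hk.1
  have hc := hk.2 c (by simp)
  obtain ⟨C, hC, h⟩ := exists_sum_nestedSum_le hg hg2 l fun a ha =>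
    hk.2 a (List.mem_cons_of_mem _ ha)
  have hs : Summable fun N : ℕ => x ^ N * (2 * C) := (summable_geometric_of_lt_one hx hx1).mul_right _
  refine ne_top_of_le_ne_top hs.tsum_ofReal_ne_top (ENNReal.tsum_le_tsum fun N => ?_)
  rw [ENNReal.ofReal_mul (by positivity), ENNReal.ofReal_pow hx]
  gcongr
  rcases Nat.eq_zero_or_pos N with rfl | hN
  · simp [nestedSum_cons_zero hg]
  refine (nestedSum_cons_le hg hg2 h c N hN).trans (ENNReal.ofReal_le_ofReal ?_)
  have h1 : (1 : ℝ) ≤ N := by exact_mod_cast hN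
  refine mul_le_of_le_one_right (by positivity) ?_
  rw [div_le_one (by positivity)]
  exact (Real.sqrt_le_self_iff.2 (Or.inr h1)).trans (le_self_pow₀ h1 hc.ne')

/-! ### Passage to the real and complex series. -/

theorem hasSum_toReal_of_tsum_ofReal {ι : Type*} {f : ι → ℝ} (hf : ∀ i, 0 ≤ f i) {S : ℝ≥0∞}
    (h : ∑' i, ENNReal.ofReal (f i) = S) (hS : S ≠ ∞) : HasSum f S.toReal := by
  subst h
  have := ENNReal.hasSum_toReal hS
  rw [← ENNReal.tsum_toReal_eq fun _ => ENNReal.ofReal_ne_top] at this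
  simpa only [ENNReal.toReal_ofReal (hf _)] using this

theorem leadPow_eq {r : ℕ} (x : ℂ) (n : Fin r → ℕ) : leadPow x n = x ^ headEntry n := by
  rcases r with _ | r
  · simp [leadPow, headEntry]
  · simp [leadPow, headEntry]

/-- The real-valued general term of the polylogarithm. -/
noncomputable def realPolylogTerm (k : List ℕ) (x : ℝ) (n : Fin k.length → ℕ) : ℝ :=
  x ^ headEntry n * ∏ i, (n i : ℝ)⁻¹ ^ k.get i

theorem realPolylogTerm_nonneg (k : List ℕ) {x : ℝ} (hx : 0 ≤ x) (n : Fin k.length → ℕ) :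
    0 ≤ realPolylogTerm k x n := by
  unfold realPolylogTerm
  positivity

theorem polylogTerm_eq (k : List ℕ) (x : ℝ) (n : Fin k.length → ℕ) :
    polylogTerm k (x : ℂ) n = (realPolylogTerm k x n : ℂ) := by
  simp only [polylogTerm, realPolylogTerm, leadPow_eq, Complex.ofReal_mul, Complex.ofReal_pow,
    Complex.ofReal_prod, Complex.ofReal_inv, Complex.ofReal_natCast, inv_pow, Finset.prod_inv_distrib,
    div_eq_mul_inv]

theorem multTTerm_eq (k : List ℕ) (n : Fin k.length → ℕ) :
    multTTerm k n = 2 ^ k.length * realPolylogTerm k 1 n := by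
  simp only [multTTerm, realPolylogTerm, one_pow, one_mul, inv_pow, Finset.prod_inv_distrib,
    div_eq_mul_inv]

theorem ofReal_realPolylogTerm (k : List ℕ) {x : ℝ} (hx : 0 ≤ x) {n : Fin k.length → ℕ}
    (hn : ∀ i, 0 < n i) :
    ENNReal.ofReal (realPolylogTerm k x n) =
      ENNReal.ofReal x ^ headEntry n * ∏ i, (n i : ℝ≥0∞)⁻¹ ^ k.get i := by
  rw [realPolylogTerm, ENNReal.ofReal_mul (by positivity), ENNReal.ofReal_pow hx,
    ENNReal.ofReal_prod_of_nonneg fun i _ => by positivity]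
  congr 1
  refine Finset.prod_congr rfl fun i _ => ?_
  have : (0 : ℝ) < n i := by exact_mod_cast hn i
  rw [ENNReal.ofReal_pow (by positivity), ENNReal.ofReal_inv_of_pos this, ENNReal.ofReal_natCast]

theorem hasSum_decTuple (k : List ℕ) {x : ℝ} (hx : 0 ≤ x)
    (h : ∑' N, ENNReal.ofReal x ^ N * nestedSum gapWeight k N ≠ ∞) :
    HasSum (fun n : DecTuple k.length => realPolylogTerm k x n.1)
      (∑' N, ENNReal.ofReal x ^ N * nestedSum gapWeight k N).toReal := by
  refine hasSum_toReal_of_tsum_ofReal (ι := DecTuple k.length)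
    (f := fun n => realPolylogTerm k x n.1) (S := ∑' N, ENNReal.ofReal x ^ N * nestedSum gapWeight k N)
    (fun n => realPolylogTerm_nonneg k hx n.1) ?_ h
  rw [← tsum_decTuple k fun N => ENNReal.ofReal x ^ N]
  exact tsum_congr fun n => ofReal_realPolylogTerm k hx n.2.2

theorem hasSum_parityTuple (k : List ℕ) {x : ℝ} (hx : 0 ≤ x)
    (h : ∑' N, ENNReal.ofReal x ^ N * nestedSum oddGapWeight k N ≠ ∞) :
    HasSum (fun n : ParityTuple k.length => 2 ^ k.length * realPolylogTerm k x n.1)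
      (∑' N, ENNReal.ofReal x ^ N * nestedSum oddGapWeight k N).toReal := by
  refine hasSum_toReal_of_tsum_ofReal (ι := ParityTuple k.length)
    (f := fun n => 2 ^ k.length * realPolylogTerm k x n.1)
    (S := ∑' N, ENNReal.ofReal x ^ N * nestedSum oddGapWeight k N)
    (fun n => mul_nonneg (by positivity) (realPolylogTerm_nonneg k hx n.1)) ?_ h
  rw [← tsum_parityTuple k fun N => ENNReal.ofReal x ^ N]
  refine tsum_congr fun n => ?_
  rw [ENNReal.ofReal_mul (by positivity), ofReal_realPolylogTerm k hx n.2.2.1,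
    ENNReal.ofReal_pow (by norm_num)]
  simp

theorem hasSum_multPolylog {k : List ℕ} (hk : IsComposition k) {x : ℝ} (hx : 0 ≤ x) (hx1 : x < 1) :
    HasSum (fun n : DecTuple k.length => polylogTerm k (x : ℂ) n.1)
      ((∑' N, ENNReal.ofReal x ^ N * nestedSum gapWeight k N).toReal : ℂ) := by
  simp only [polylogTerm_eq]
  exact Complex.hasSum_ofReal.2 (hasSum_decTuple k hx
    (tsum_pow_mul_nestedSum_ne_top gapWeight_zero gapWeight_le hk hx hx1))

theorem hasSum_kanekoTsumuraA {k : List ℕ} (hk : IsComposition k) {x : ℝ} (hx : 0 ≤ x)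
    (hx1 : x < 1) :
    HasSum (fun n : ParityTuple k.length => 2 ^ k.length * polylogTerm k (x : ℂ) n.1)
      ((∑' N, ENNReal.ofReal x ^ N * nestedSum oddGapWeight k N).toReal : ℂ) := by
  have := Complex.hasSum_ofReal.2 (hasSum_parityTuple k hx
    (tsum_pow_mul_nestedSum_ne_top oddGapWeight_zero oddGapWeight_le hk hx hx1))
  simpa only [polylogTerm_eq, Complex.ofReal_mul, Complex.ofReal_pow, Complex.ofReal_ofNat] using this

theorem multPolylog_eq {k : List ℕ} (hk : IsComposition k) {x : ℝ} (hx : 0 ≤ x) (hx1 : x < 1) :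
    multPolylog k (x : ℂ) = ((∑' N, ENNReal.ofReal x ^ N * nestedSum gapWeight k N).toReal : ℂ) :=
  (hasSum_multPolylog hk hx hx1).tsum_eq

theorem kanekoTsumuraA_eq {k : List ℕ} (hk : IsComposition k) {x : ℝ} (hx : 0 ≤ x) (hx1 : x < 1) :
    kanekoTsumuraA k (x : ℂ) =
      ((∑' N, ENNReal.ofReal x ^ N * nestedSum oddGapWeight k N).toReal : ℂ) := by
  rw [kanekoTsumuraA, ← tsum_mul_left]
  exact (hasSum_kanekoTsumuraA hk hx hx1).tsum_eq

theorem hasSum_multT {k : List ℕ} (h : ∑' N, nestedSum oddGapWeight k N ≠ ∞) :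
    HasSum (fun n : ParityTuple k.length => multTTerm k n.1)
      (∑' N, nestedSum oddGapWeight k N).toReal := by
  have := hasSum_parityTuple k zero_le_one (by simpa using h)
  simpa only [multTTerm_eq, ENNReal.ofReal_one, one_pow, one_mul] using this

/-- The truncation constrains only the largest index, so it is the tuple sum with `φ` the indicator
of `M ≤ N`. -/
theorem multHarmonicSum_eq (k : List ℕ) (N : ℕ) :
    multHarmonicSum k N = (∑ M ∈ Finset.range (N + 1), nestedSum gapWeight k M).toReal := by
  classical
  have e1 : ∑ M ∈ Finset.range (N + 1), nestedSum gapWeight k M =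
      ∑' M, (if M ≤ N then 1 else 0) * nestedSum gapWeight k M := by
    rw [tsum_eq_sum (s := Finset.range (N + 1))]
    · refine Finset.sum_congr rfl fun M hM => ?_
      rw [if_pos (by simpa [Nat.lt_succ_iff] using hM), one_mul]
    · intro M hM
      rw [if_neg (by simpa using hM), zero_mul]
  rw [e1, ← tsum_tuple_eq gapWeight_zero
    (fun r n => if StrictAnti n ∧ ∀ i, 0 < n i then 1 else 0)
    (fun n => if_pos ⟨Subsingleton.strictAnti _, fun i => i.elim0⟩) (fun r N n => ?_) k
    (fun M => if M ≤ N then 1 else 0)]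
  · have hmem : ∀ n : Fin k.length → ℕ, n ∈ (Fintype.piFinset fun _ : Fin k.length =>
        Finset.Icc 1 N).filter (fun n => StrictAnti n) ↔
          (StrictAnti n ∧ ∀ i, 0 < n i) ∧ headEntry n ≤ N := by
      intro n
      simp only [Finset.mem_filter, Fintype.mem_piFinset, Finset.mem_Icc]
      constructor
      · rintro ⟨h1, h2⟩
        refine ⟨⟨h2, fun i => (h1 i).1⟩, ?_⟩
        unfold headEntry
        split_ifs
        · exact (h1 _).2
        · exact Nat.zero_le _
      · rintro ⟨⟨h1, h2⟩, h3⟩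
        refine ⟨fun i => ⟨h2 i, ?_⟩, h1⟩
        rw [headEntry, dif_pos i.pos] at h3
        exact (h1.antitone (show (⟨0, i.pos⟩ : Fin k.length) ≤ i from Nat.zero_le _)).trans h3
    rw [multHarmonicSum, tsum_eq_sum (s := (Fintype.piFinset fun _ : Fin k.length =>
      Finset.Icc 1 N).filter (fun n => StrictAnti n))]
    · rw [ENNReal.toReal_sum]
      · refine Finset.sum_congr (by congr) fun n hn => ?_
        obtain ⟨h1, h2⟩ := (hmem n).1 hn
        simp [if_pos h1, if_pos h2, ENNReal.toReal_prod]
      · intro n hn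
        obtain ⟨h1, h2⟩ := (hmem n).1 hn
        rw [if_pos h1, if_pos h2, one_mul, one_mul]
        refine ENNReal.prod_ne_top fun i _ => ENNReal.pow_ne_top (ENNReal.inv_ne_top.2 ?_)
        exact_mod_cast (h1.2 i).ne'
    · intro n hn
      rw [hmem, not_and_or] at hn
      rcases hn with hn | hn <;> simp [hn]
  · simp only [strictAnti_cons_iff, gapWeight, Nat.sub_eq_zero_iff_le, ← not_lt]
    by_cases h1 : StrictAnti n ∧ ∀ i, 0 < n i <;> by_cases h2 : headEntry n < N <;> simp [h1, h2]

theorem tendsto_multHarmonicSum {k : List ℕ} (h : ∑' N, nestedSum gapWeight k N ≠ ∞) :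
    Tendsto (multHarmonicSum k) atTop (𝓝 (∑' N, nestedSum gapWeight k N).toReal) := by
  have h1 := (ENNReal.tendsto_toReal h).comp
    ((ENNReal.tendsto_nat_tsum (nestedSum gapWeight k)).comp (tendsto_add_atTop_nat 1))
  refine h1.congr fun N => ?_
  rw [multHarmonicSum_eq]
  rfl

theorem multZeta_eq {k : List ℕ} (h : ∑' N, nestedSum gapWeight k N ≠ ∞) :
    multZeta k = (∑' N, nestedSum gapWeight k N).toReal :=
  (tendsto_multHarmonicSum h).limUnder_eq

/-! ### The two kernels -/

theorem tsum_gapWeight_mul_pow {x : ℝ} (hx : 0 ≤ x) (hx1 : x < 1) :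
    ∑' d, gapWeight d * ENNReal.ofReal x ^ d = ENNReal.ofReal (x / (1 - x)) := by
  rw [tsum_eq_zero_add' ENNReal.summable]
  have : ∀ d, gapWeight (d + 1) * ENNReal.ofReal x ^ (d + 1) =
      ENNReal.ofReal x * ENNReal.ofReal x ^ d := by
    intro d
    rw [gapWeight, if_neg (by omega), one_mul, pow_succ']
  simp_rw [this]
  rw [gapWeight_zero, zero_mul, zero_add, ENNReal.tsum_mul_left, ENNReal.tsum_geometric,
    ENNReal.ofReal_div_of_pos (by linarith), ENNReal.ofReal_sub _ hx, ENNReal.ofReal_one,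
    div_eq_mul_inv]

theorem tsum_oddGapWeight_mul_pow {x : ℝ} (hx : 0 ≤ x) (hx1 : x < 1) :
    ∑' d, oddGapWeight d * ENNReal.ofReal x ^ d = ENNReal.ofReal (2 * x / (1 - x ^ 2)) := by
  rw [← tsum_even_add_odd ENNReal.summable ENNReal.summable]
  have h1 : ∀ d, oddGapWeight (2 * d) * ENNReal.ofReal x ^ (2 * d) = 0 := by
    intro d
    rw [oddGapWeight, if_neg (by simp), zero_mul]
  have h2 : ∀ d, oddGapWeight (2 * d + 1) * ENNReal.ofReal x ^ (2 * d + 1) =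
      2 * ENNReal.ofReal x * (ENNReal.ofReal x ^ 2) ^ d := by
    intro d
    rw [oddGapWeight, if_pos (odd_two_mul_add_one d), pow_succ', pow_mul, mul_assoc]
  simp_rw [h1, h2]
  rw [tsum_zero, zero_add, ENNReal.tsum_mul_left, ENNReal.tsum_geometric,
    ENNReal.ofReal_div_of_pos (by nlinarith), ENNReal.ofReal_sub _ (by positivity),
    ENNReal.ofReal_one, ENNReal.ofReal_mul (by norm_num), ENNReal.ofReal_pow hx,
    div_eq_mul_inv]
  simp

/-- The antiderivative is `x^N / N`. Since `G` may blow up at 0, the derivative is used only inside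
the interval; nonnegativity and continuity up to the endpoint give integrability. -/
theorem lintegral_Ioc_ofReal_mul_pow {x G : ℝ → ℝ} (hx0 : x 0 = 0) (hxc : Continuous x)
    (hxn : ∀ s, 0 < s → 0 ≤ x s) (hG : ∀ s, 0 < s → 0 ≤ G s)
    (hd : ∀ s, 0 < s → HasDerivAt x (G s * x s) s) (t : ℝ) (ht : 0 < t) (N : ℕ) (hN : N ≠ 0) :
    ∫⁻ s in Ioc 0 t, ENNReal.ofReal (G s) * ENNReal.ofReal (x s) ^ N =
      ENNReal.ofReal (x t) ^ N * (N : ℝ≥0∞)⁻¹ := by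
  have hN' : (0 : ℝ) < N := by positivity
  have hcont : ContinuousOn (fun s => x s ^ N / N) (Icc 0 t) := by fun_prop
  have hder : ∀ s ∈ Ioo 0 t, HasDerivAt (fun s => x s ^ N / N) (G s * x s ^ N) s := by
    intro s hs
    refine (((hd s hs.1).fun_pow N).div_const (N : ℝ)).congr_deriv ?_
    rw [← Nat.succ_pred_eq_of_ne_zero hN]
    field_simp
    simp [pow_succ]
    ring
  have hpos : ∀ s ∈ Ioo 0 t, 0 ≤ G s * x s ^ N := fun s hs =>
    mul_nonneg (hG s hs.1) (pow_nonneg (hxn s hs.1) _)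
  have hint := intervalIntegral.integrableOn_deriv_of_nonneg hcont hder hpos
  have hval := intervalIntegral.integral_eq_sub_of_hasDerivAt_of_le ht.le hcont hder
    ((intervalIntegrable_iff_integrableOn_Ioc_of_le ht.le).2 hint)
  have e : ∀ s ∈ Ioc 0 t, ENNReal.ofReal (G s) * ENNReal.ofReal (x s) ^ N =
      ENNReal.ofReal (G s * x s ^ N) := by
    intro s hs
    rw [ENNReal.ofReal_mul (hG s hs.1), ENNReal.ofReal_pow (hxn s hs.1)]
  rw [setLIntegral_congr_fun measurableSet_Ioc e, ← ofReal_integral_eq_lintegral_ofReal hint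
    ((ae_restrict_iff' measurableSet_Ioc).2 (ae_of_all _ fun s hs =>
      mul_nonneg (hG s hs.1) (pow_nonneg (hxn s hs.1) _))),
    ← intervalIntegral.integral_of_le ht.le, hval]
  simp only [hx0, zero_pow hN, zero_div, sub_zero]
  rw [ENNReal.ofReal_div_of_pos hN', ENNReal.ofReal_pow (hxn t ht), ENNReal.ofReal_natCast,
    div_eq_mul_inv]

/-- The series is `u / (1 - u)`, which is `1 / (e^t - 1)` at `u = e^{-t}` and the reciprocal at `u =
1 - e^{-t}`: the involution `u ↦ 1 - u` inverts it. -/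
theorem dualKernel_gapWeight : DualKernel gapWeight
    (fun t => ENNReal.ofReal (1 - Real.exp (-t)))
    (fun t => ENNReal.ofReal (1 / (Real.exp t - 1))) where
  measurable_x := by fun_prop
  measurable_G := by fun_prop
  g_zero := gapWeight_zero
  tsum_exp t ht := by
    rw [tsum_gapWeight_mul_pow (Real.exp_nonneg _) (by simpa using ht)]
    congr 1
    have : 1 < Real.exp t := by simpa using ht
    have h2 : Real.exp t - 1 ≠ 0 := by linarith
    have h3 : 1 - (Real.exp t)⁻¹ ≠ 0 := by
      field_simp
      exact div_ne_zero h2 (Real.exp_ne_zero t)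
    rw [Real.exp_neg]
    field_simp
  tsum_x t ht := by
    have : 1 < Real.exp t := by simpa using ht
    have h0 : Real.exp (-t) ≤ 1 := by simpa using ht.le
    rw [tsum_gapWeight_mul_pow (by linarith) (by linarith [Real.exp_pos (-t)]),
      ← ENNReal.ofReal_mul (one_div_nonneg.2 (by linarith)), ENNReal.ofReal_eq_one]
    have h2 : Real.exp t - 1 ≠ 0 := by linarith
    rw [sub_sub_cancel, Real.exp_neg]
    field_simp
  lintegral_x := by
    refine lintegral_Ioc_ofReal_mul_pow (x := fun t => 1 - Real.exp (-t)) (by simp) (by fun_prop)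
      (fun s hs => ?_) (fun s hs => ?_) (fun s hs => ?_)
    · have : Real.exp (-s) ≤ 1 := by simpa using hs.le
      linarith
    · have : 1 < Real.exp s := by simpa using hs
      exact one_div_nonneg.2 (by linarith)
    · have : 1 < Real.exp s := by simpa using hs
      have h2 : Real.exp s - 1 ≠ 0 := by linarith
      refine (((hasDerivAt_id s).neg.exp).const_sub 1).congr_deriv ?_
      simp only [id, Pi.neg_apply, Real.exp_neg]
      field_simp

theorem sinh_eq_two_mul_half (t : ℝ) :
    Real.sinh t = 2 * Real.sinh (t / 2) * Real.cosh (t / 2) := by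
  rw [← Real.sinh_two_mul]; ring_nf

theorem tanh_half_nonneg {t : ℝ} (ht : 0 < t) : 0 ≤ Real.tanh (t / 2) := by
  rw [Real.tanh_eq_sinh_div_cosh]
  exact div_nonneg (Real.sinh_nonneg_iff.2 (by linarith)) (Real.cosh_pos _).le

/-- The series is `2u / (1 - u²)`, inverted by `u ↦ (1 - u) / (1 + u)`, which exchanges `e^{-t}` and
`tanh (t / 2)`; the two values are `1 / sinh t` and `sinh t`. -/
theorem dualKernel_oddGapWeight : DualKernel oddGapWeight
    (fun t => ENNReal.ofReal (Real.tanh (t / 2)))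
    (fun t => ENNReal.ofReal (1 / Real.sinh t)) where
  measurable_x := by
    simp only [Real.tanh_eq_sinh_div_cosh]
    fun_prop
  measurable_G := by fun_prop
  g_zero := oddGapWeight_zero
  tsum_exp t ht := by
    have h1 : Real.exp (-t) < 1 := by simpa using ht
    rw [tsum_oddGapWeight_mul_pow (Real.exp_nonneg _) h1]
    congr 1
    have h2 : 1 < Real.exp t := by simpa using ht
    have h3 : Real.exp t ^ 2 - 1 ≠ 0 := by nlinarith
    have h4 : 1 - (Real.exp t)⁻¹ ^ 2 ≠ 0 := by
      field_simp
      exact div_ne_zero h3 (by positivity)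
    have h5 : Real.exp t - (Real.exp t)⁻¹ ≠ 0 := by
      field_simp
      exact div_ne_zero h3 (by positivity)
    rw [Real.sinh_eq, Real.exp_neg]
    field_simp
  tsum_x t ht := by
    have hs : 0 < Real.sinh (t / 2) := Real.sinh_pos_iff.2 (by linarith)
    have hc : 0 < Real.cosh (t / 2) := Real.cosh_pos _
    have h1 := Real.cosh_sq (t / 2)
    rw [tsum_oddGapWeight_mul_pow (tanh_half_nonneg ht) (Real.tanh_lt_one _),
      ← ENNReal.ofReal_mul (one_div_nonneg.2 (Real.sinh_nonneg_iff.2 ht.le)),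
      ENNReal.ofReal_eq_one, sinh_eq_two_mul_half, Real.tanh_eq_sinh_div_cosh]
    have h2 : 1 - (Real.sinh (t / 2) / Real.cosh (t / 2)) ^ 2 = 1 / Real.cosh (t / 2) ^ 2 := by
      field_simp
      linarith
    rw [h2]
    field_simp
  lintegral_x := by
    refine lintegral_Ioc_ofReal_mul_pow (x := fun t => Real.tanh (t / 2)) (by simp) ?_
      (fun s hs => tanh_half_nonneg hs)
      (fun s hs => one_div_nonneg.2 (Real.sinh_nonneg_iff.2 hs.le)) (fun s hs => ?_)
    · simp only [Real.tanh_eq_sinh_div_cosh]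
      exact (Real.continuous_sinh.comp (continuous_id.div_const 2)).div
        (Real.continuous_cosh.comp (continuous_id.div_const 2)) fun t => (Real.cosh_pos _).ne'
    · have hs' : 0 < Real.sinh (s / 2) := Real.sinh_pos_iff.2 (by linarith)
      have hc : 0 < Real.cosh (s / 2) := Real.cosh_pos _
      have h1 := Real.cosh_sq (s / 2)
      simp only [Real.tanh_eq_sinh_div_cosh]
      have hid := (hasDerivAt_id s).div_const 2
      refine (hid.sinh.div hid.cosh hc.ne').congr_deriv ?_
      simp only [id]
      rw [sinh_eq_two_mul_half s]
      field_simp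
      linarith

/-! ### Mellin transforms and the final evaluation. -/

theorem integrableOn_and_integral_toReal {f : ℝ → ℂ} {w : ℝ → ℝ≥0∞} (hw : Measurable w)
    (hfin : ∫⁻ t in Ioi (0 : ℝ), w t ≠ ∞) (hf : ∀ t ∈ Ioi (0 : ℝ), f t = ((w t).toReal : ℂ)) :
    IntegrableOn f (Ioi 0) ∧ ∫ t in Ioi (0 : ℝ), f t = ((∫⁻ t in Ioi (0 : ℝ), w t).toReal : ℂ) := by
  constructor
  · refine IntegrableOn.congr_fun ?_ (fun t ht => (hf t ht).symm) measurableSet_Ioi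
    exact (integrable_toReal_of_lintegral_ne_top hw.aemeasurable hfin).ofReal
  · rw [setIntegral_congr_fun measurableSet_Ioi hf, integral_complex_ofReal,
      integral_toReal hw.aemeasurable (ae_lt_top hw hfin)]

/-- Evaluation of the normalised Mellin transform of a generating function. -/
theorem DualKernel.mellin_eq {g : ℕ → ℝ≥0∞} {x G : ℝ → ℝ≥0∞} (h : DualKernel g x G) (m : ℕ)
    {k : List ℕ} (hk : IsComposition k) {f : ℝ → ℂ}
    (hf : ∀ t ∈ Ioi (0 : ℝ), f t = ((G t * ENNReal.ofReal (t ^ m) * nestedGen g x k t).toReal : ℂ))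
    (hfin : ∑' N, nestedSumCoeff g (plusOne (hoffmanDual k.reverse)) N m ≠ ∞) :
    IntegrableOn f (Ioi 0) ∧ 1 / Complex.Gamma (m + 1) * ∫ t in Ioi (0 : ℝ), f t =
      ((∑' N, nestedSumCoeff g (plusOne (hoffmanDual k.reverse)) N m).toReal : ℂ) := by
  have hG := h.measurable_G
  have hL := h.measurable_nestedGen k
  have hm : (0 : ℝ) < m.factorial := by positivity
  have e : ∀ t, G t * ENNReal.ofReal (t ^ m) * nestedGen g x k t = m.factorial *
      (G t * ENNReal.ofReal (t ^ m / m.factorial) * nestedGen g x k t) := by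
    intro t
    have : ENNReal.ofReal (t ^ m) = m.factorial * ENNReal.ofReal (t ^ m / m.factorial) := by
      rw [← ENNReal.ofReal_natCast, ← ENNReal.ofReal_mul hm.le, mul_div_cancel₀ _ hm.ne']
    rw [this]
    ring
  have hint : ∫⁻ t in Ioi (0 : ℝ), G t * ENNReal.ofReal (t ^ m) * nestedGen g x k t =
      m.factorial * ∑' N, nestedSumCoeff g (plusOne (hoffmanDual k.reverse)) N m := by
    simp_rw [e]
    rw [lintegral_const_mul _ (by fun_prop), h.lintegral_nestedGen m hk]
  obtain ⟨h1, h2⟩ := integrableOn_and_integral_toReal (f := f)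
    (w := fun t => G t * ENNReal.ofReal (t ^ m) * nestedGen g x k t) (by fun_prop)
    (by rw [hint]; exact ENNReal.mul_ne_top (ENNReal.natCast_ne_top _) hfin) hf
  refine ⟨h1, ?_⟩
  rw [h2, hint, Complex.Gamma_nat_eq_factorial, ENNReal.toReal_mul, ENNReal.toReal_natCast,
    Complex.ofReal_mul, Complex.ofReal_natCast, ← mul_assoc, one_div,
    inv_mul_cancel₀ (by exact_mod_cast hm.ne'), one_mul]

/-- The plus makes the leading entry at least 2, and adding `j` can only increase entries. -/
theorem tsum_nestedSum_addComp_ne_top {g : ℕ → ℝ≥0∞} (hg : g 0 = 0) (hg2 : ∀ d, g d ≤ 2)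
    {q : List ℕ} (hq : IsComposition q) {n : ℕ} (hn : q.length = n) (j : Fin n → ℕ) :
    ∑' N, nestedSum g (addComp (plusOne q) (List.ofFn j)) N ≠ ∞ := by
  obtain ⟨c, l, rfl⟩ := List.exists_cons_of_ne_nil hq.1
  obtain rfl : n = l.length + 1 := hn.symm
  have hc := hq.2 c (by simp)
  simp only [addComp, plusOne, List.ofFn_succ, List.zipWith_cons_cons]
  refine tsum_nestedSum_ne_top hg hg2 (by omega) _ fun a ha => ?_
  obtain ⟨i, hi, rfl⟩ := List.mem_iff_getElem.1 ha
  rw [List.getElem_zipWith]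
  exact Nat.add_pos_left (hq.2 _ (List.mem_cons_of_mem _ (List.getElem_mem _))) _

theorem tsum_nestedSumCoeff_plusOne {g : ℕ → ℝ≥0∞} (hg : g 0 = 0) (hg2 : ∀ d, g d ≤ 2)
    {q : List ℕ} (hq : IsComposition q) {n : ℕ} (hn : q.length = n) (m : ℕ) :
    ∑' N, nestedSumCoeff g (plusOne q) N m ≠ ∞ ∧
    (∑' N, nestedSumCoeff g (plusOne q) N m).toReal = ∑ j ∈ Finset.Nat.antidiagonalTuple n m,
      (multiBinom (plusOne q) (List.ofFn j) : ℝ) *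
        (∑' N, nestedSum g (addComp (plusOne q) (List.ofFn j)) N).toReal := by
  have hfin := tsum_nestedSum_addComp_ne_top hg hg2 hq hn
  have e : ∑' N, nestedSumCoeff g (plusOne q) N m = ∑ j ∈ Finset.Nat.antidiagonalTuple n m,
      (multiBinom (plusOne q) (List.ofFn j) : ℝ≥0∞) *
        ∑' N, nestedSum g (addComp (plusOne q) (List.ofFn j)) N := by
    simp_rw [nestedSumCoeff_eq_sum g (plusOne q) ((length_plusOne q).trans hn) _ m,
      ← ENNReal.tsum_mul_left]
    exact Summable.tsum_finsetSum fun _ _ => ENNReal.summable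
  have hne : ∀ j ∈ Finset.Nat.antidiagonalTuple n m,
      (multiBinom (plusOne q) (List.ofFn j) : ℝ≥0∞) *
        ∑' N, nestedSum g (addComp (plusOne q) (List.ofFn j)) N ≠ ∞ :=
    fun j _ => ENNReal.mul_ne_top (ENNReal.natCast_ne_top _) (hfin j)
  rw [e]
  refine ⟨ENNReal.sum_ne_top.2 hne, ?_⟩
  rw [ENNReal.toReal_sum hne]
  simp

theorem cpow_natCast_succ_sub_one (t : ℝ) (m : ℕ) :
    (t : ℂ) ^ ((m + 1 : ℂ) - 1) = ((t ^ m : ℝ) : ℂ) := by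
  simp

theorem xiIntegrand_eq (m : ℕ) {k : List ℕ} (hk : IsComposition k) {t : ℝ} (ht : 0 < t) :
    xiIntegrand (m + 1) k t = ((ENNReal.ofReal (1 / (Real.exp t - 1)) * ENNReal.ofReal (t ^ m) *
      nestedGen gapWeight (fun t => ENNReal.ofReal (1 - Real.exp (-t))) k t).toReal : ℂ) := by
  have h1 : Real.exp (-t) ≤ 1 := by simpa using ht.le
  have h2 : 1 < Real.exp t := by simpa using ht
  rw [xiIntegrand, multPolylog_eq hk (by linarith) (by linarith [Real.exp_pos (-t)]),
    cpow_natCast_succ_sub_one, ENNReal.toReal_mul, ENNReal.toReal_mul,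
    ENNReal.toReal_ofReal (one_div_nonneg.2 (by linarith)), ENNReal.toReal_ofReal (by positivity),
    nestedGen]
  push_cast
  ring

theorem psiIntegrand_eq (m : ℕ) {k : List ℕ} (hk : IsComposition k) {t : ℝ} (ht : 0 < t) :
    psiIntegrand (m + 1) k t = ((ENNReal.ofReal (1 / Real.sinh t) * ENNReal.ofReal (t ^ m) *
      nestedGen oddGapWeight (fun t => ENNReal.ofReal (Real.tanh (t / 2))) k t).toReal : ℂ) := by
  rw [psiIntegrand, kanekoTsumuraA_eq hk (tanh_half_nonneg ht) (Real.tanh_lt_one _),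
    cpow_natCast_succ_sub_one, ENNReal.toReal_mul, ENNReal.toReal_mul,
    ENNReal.toReal_ofReal (one_div_nonneg.2 (Real.sinh_nonneg_iff.2 ht.le)),
    ENNReal.toReal_ofReal (by positivity), nestedGen]
  push_cast
  ring

theorem mainTheorem5 (k : List ℕ) (hk : IsComposition k) (m : ℕ) :
    -- well-definedness: the series and integrals that occur converge
    ((∀ t : ℝ, 0 < t → Summable fun n : DecTuple k.length =>
        polylogTerm k ((1 - Real.exp (-t) : ℝ) : ℂ) n.1) ∧
      (∀ t : ℝ, 0 < t → Summable fun n : ParityTuple k.length =>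
        polylogTerm k (Real.tanh (t / 2) : ℂ) n.1) ∧
      MeasureTheory.IntegrableOn (xiIntegrand (m + 1) k) (Set.Ioi 0) ∧
      MeasureTheory.IntegrableOn (psiIntegrand (m + 1) k) (Set.Ioi 0) ∧
      ∀ j ∈ Finset.Nat.antidiagonalTuple (k.sum + 1 - k.length) m,
        Tendsto (multHarmonicSum (addComp (plusOne (hoffmanDual k.reverse)) (List.ofFn j))) atTop
          (𝓝 (multZeta (addComp (plusOne (hoffmanDual k.reverse)) (List.ofFn j)))) ∧
        Summable fun n :
            ParityTuple (addComp (plusOne (hoffmanDual k.reverse)) (List.ofFn j)).length =>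
          multTTerm (addComp (plusOne (hoffmanDual k.reverse)) (List.ofFn j)) n.1) ∧
    -- the two evaluations
    arakawaKanekoXi (m + 1) k =
      ((∑ j ∈ Finset.Nat.antidiagonalTuple (k.sum + 1 - k.length) m,
        (multiBinom (plusOne (hoffmanDual k.reverse)) (List.ofFn j) : ℝ) *
          multZeta (addComp (plusOne (hoffmanDual k.reverse)) (List.ofFn j)) : ℝ) : ℂ) ∧
    kanekoTsumuraPsi (m + 1) k =
      ((∑ j ∈ Finset.Nat.antidiagonalTuple (k.sum + 1 - k.length) m,
        (multiBinom (plusOne (hoffmanDual k.reverse)) (List.ofFn j) : ℝ) *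
          multT (addComp (plusOne (hoffmanDual k.reverse)) (List.ofFn j)) : ℝ) : ℂ) := by
  have hr : IsComposition k.reverse :=
    ⟨by simpa using hk.1, fun a ha => hk.2 a (List.mem_reverse.1 ha)⟩
  have hd := hoffmanDual_isComposition hr
  have hn : (hoffmanDual k.reverse).length = k.sum + 1 - k.length := by
    rw [← length_plusOne, length_plusOne_hoffmanDual_reverse hk]
  have hz := tsum_nestedSum_addComp_ne_top gapWeight_zero gapWeight_le hd hn
  have hT := tsum_nestedSum_addComp_ne_top oddGapWeight_zero oddGapWeight_le hd hn
  obtain ⟨xfin, xval⟩ := tsum_nestedSumCoeff_plusOne gapWeight_zero gapWeight_le hd hn m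
  obtain ⟨pfin, pval⟩ := tsum_nestedSumCoeff_plusOne oddGapWeight_zero oddGapWeight_le hd hn m
  obtain ⟨xint, xeq⟩ := dualKernel_gapWeight.mellin_eq m hk
    (fun t ht => xiIntegrand_eq m hk ht) xfin
  obtain ⟨pint, peq⟩ := dualKernel_oddGapWeight.mellin_eq m hk
    (fun t ht => psiIntegrand_eq m hk ht) pfin
  refine ⟨⟨fun t ht => ?_, fun t ht => ?_, xint, pint, fun j _ => ⟨?_, ?_⟩⟩, ?_, ?_⟩
  · have : Real.exp (-t) ≤ 1 := by simpa using ht.le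
    exact (hasSum_multPolylog hk (by linarith) (by linarith [Real.exp_pos (-t)])).summable
  · have := (hasSum_kanekoTsumuraA hk (tanh_half_nonneg ht) (Real.tanh_lt_one _)).summable
    exact (summable_mul_left_iff (pow_ne_zero _ two_ne_zero)).1 this
  · rw [multZeta_eq (hz j)]
    exact tendsto_multHarmonicSum (hz j)
  · exact (hasSum_multT (hT j)).summable
  · rw [arakawaKanekoXi, xeq, xval]
    simp_rw [multZeta_eq (hz _)]
  · rw [kanekoTsumuraPsi, peq, pval]
    simp_rw [multT, (hasSum_multT (hT _)).tsum_eq]
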